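/- Let $B$ be a poset and let $\Psi: B^{op}\to \mathrm{Poset}$ be a functor. Let $S=\bigsqcup_{x\in B}\Psi(x)$ be ordered by: for $a\in\Psi(x)$ and $b\in\Psi(y)$, $a\le b$ iff $x\le y$ in $B$ and $a\le \Psi(x\le y)(b)$ in $\Psi(x)$; let $\pi:S\to B$ be the projection. A presheaf (copresheaf) on a poset $P$ is a functor $P^{op}\to \mathrm{Ab}$ ($P\to \mathrm{Ab}$). For a presheaf $\mathcal F$ and a copresheaf $\mathcal G$ on $P$ let $$\mathcal F\otimes_P\mathcal G=\mathrm{coeq}\Big(\bigoplus_{y\le x}\mathcal F(x)\otimes\mathcal G(y)\rightrightarrows\bigoplus_{p\in P}\mathcal F(p)\otimes\mathcal G(p)\Big)$$ (the two maps being $\mathcal F(y\le x)\otimes 1$ and $1\otimes\mathcal G(y\le x)$), let $\mathrm{Tor}^P_n(\mathcal F,\mathcal G)=L_n(-\otimes_P\mathcal G)(\mathcal F)$ be the $n$-th left derived functor, and let $H_n(P;\mathcal F)=\mathrm{Tor}^P_n(\mathcal F,\overline{\mathbb Z})$, where $\overline{\mathbb Z}$ is the constant copresheaf with value $\mathbb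 Z$. For a presheaf $\mathcal F$ on $S$ let $H_n(\Psi;\mathcal F)$ be the presheaf $x\mapsto H_n(\Psi(x);\mathcal F|_{\Psi(x)})$ on $B$, whose restriction maps for $x\le y$ are induced by $\Psi(x\le y):\Psi(y)\to\Psi(x)$ and the restrictions $\mathcal F(b)\to\mathcal F(\Psi(x\le y)(b))$, $b\in\Psi(y)$. Then for every presheaf $\mathcal F$ on $S$ and every copresheaf $\mathcal G$ on $B$ there is a first quadrant spectral sequence of abelian groups $(E^r_{p,q})_{r\ge 2,\ p,q\ge 0}$, with differentials $d^r:E^r_{p,q}\to E^r_{p+r-1,\,q-r}$, such that $$E^2_{p,q}\cong \mathrm{Tor}^B_q\big(H_p(\Psi;\mathcal F),\mathcal G\big)\qquad (p,q\ge 0),$$ and which converges to $\mathrm{Tor}^S_*(\mathcal F,\pi^*\mathcal G)$, where $\pi^*\mathcal G=\mathcal G\circ\pi$. That is, for every $n\ge 0$ the group $T_n=\mathrm{Tor}^S_n(\mathcal F,\pi^*\mathcal G)$ has a filtration by subgroups $0=\Phi_{-1}\subseteq\Phi_0\subseteq\dots\subseteq\Phi_n=T_n$ with $\Phi_q/\Phi_{q-1}\cong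 E^\infty_{p,q}$ for all $p,q\ge 0$ with $p+q=n$, where $E^\infty_{p,q}=E^r_{p,q}$ for all sufficiently large $r$, namely for $r\ge\max(p+2,\,q+1)$. -/

import Mathlib

open CategoryTheory CategoryTheory.Limits Opposite
open scoped TensorProduct
attribute [-instance] CategoryTheory.catToReflQuiver
universe u
namespace PosetTor

section Lift

variable {C D E A : Type*} [Category* C] [Category* D] [Category* E] [Category* A]
  [Abelian C] [Abelian D] [Abelian E] [Abelian A]

/-- `⋯ → K₁ → K₀ → Z → 0` is exact, with augmentation `ε : K₀ ⟶ Z`. -/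
structure IsRes (K : ChainComplex C ℕ) {Z : C} (ε : K.X 0 ⟶ Z) : Prop where
  w : K.d 1 0 ≫ ε = 0
  epi : Epi ε
  exact₀ : (ShortComplex.mk _ _ w).Exact
  exactSucc (n : ℕ) : (ShortComplex.mk _ _ (K.d_comp_d (n + 2) (n + 1) n)).Exact

/-- The augmentation of a projective resolution. -/
noncomputable def aug {X : C} (P : ProjectiveResolution X) : P.complex.X 0 ⟶ X := P.π.f 0

theorem isRes_aug {X : C} (P : ProjectiveResolution X) : IsRes P.complex (aug P) :=
  ⟨P.complex_d_comp_π_f_zero, inferInstanceAs (Epi (P.π.f 0)), P.exact₀, P.exact_succ⟩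

theorem IsRes.map {K : ChainComplex D ℕ} {Z : D} {ε : K.X 0 ⟶ Z} (h : IsRes K ε)
    (R : D ⥤ C) [R.Additive] [R.PreservesHomology] :
    IsRes (Z := R.obj Z) ((R.mapHomologicalComplex _).obj K) (R.map ε) where
  w := by
    have := h.w
    change R.map (K.d 1 0) ≫ R.map ε = 0
    rw [← R.map_comp, this, R.map_zero]
  epi := by
    have := h.epi
    exact R.map_epi ε
  exact₀ := h.exact₀.map R
  exactSucc n := (h.exactSucc n).map R

variable {P K : ChainComplex C ℕ} [∀ n, Projective (P.X n)] {X Z : C} {π : P.X 0 ⟶ X}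
  {ε : K.X 0 ⟶ Z}

theorem IsRes.exists_lift (h : IsRes K ε) (hπ : P.d 1 0 ≫ π = 0) (k : X ⟶ Z) :
    ∃ φ : P ⟶ K, φ.f 0 ≫ ε = π ≫ k := by
  have := h.epi
  let z : P.X 0 ⟶ K.X 0 := Projective.factorThru (π ≫ k) ε
  have hz : z ≫ ε = π ≫ k := Projective.factorThru_comp _ _
  let o : P.X 1 ⟶ K.X 1 := h.exact₀.liftFromProjective (P.d 1 0 ≫ z) (by
    simp [hz, reassoc_of% hπ])
  have ho : o ≫ K.d 1 0 = P.d 1 0 ≫ z := h.exact₀.liftFromProjective_comp _ _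
  exact ⟨ChainComplex.mkHom _ _ z o ho fun n p =>
    ⟨(h.exactSucc n).liftFromProjective (P.d (n + 2) (n + 1) ≫ p.2.1) (by
      simp [p.2.2]), (h.exactSucc n).liftFromProjective_comp _ _⟩, by simpa using hz⟩

theorem IsRes.homotopy_zero (h : IsRes K ε) (φ : P ⟶ K) (hφ : φ.f 0 ≫ ε = 0) :
    Nonempty (Homotopy φ 0) := by
  let z : P.X 0 ⟶ K.X 1 := h.exact₀.liftFromProjective (φ.f 0) hφ
  have hz : z ≫ K.d 1 0 = φ.f 0 := h.exact₀.liftFromProjective_comp _ _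
  let o : P.X 1 ⟶ K.X 2 :=
    (h.exactSucc 0).liftFromProjective (φ.f 1 - P.d 1 0 ≫ z) (by simp [hz])
  have ho : o ≫ K.d 2 1 = φ.f 1 - P.d 1 0 ≫ z := (h.exactSucc 0).liftFromProjective_comp _ _
  exact ⟨Homotopy.mkInductive φ z hz.symm o (by simp [ho]) fun n p =>
    ⟨(h.exactSucc (n + 1)).liftFromProjective (φ.f (n + 2) - P.d (n + 2) (n + 1) ≫ p.2.1) (by
        simp [p.2.2]), by
      have e : _ ≫ K.d (n + 3) (n + 2) = _ := (h.exactSucc (n + 1)).liftFromProjective_comp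
        (φ.f (n + 2) - P.d (n + 2) (n + 1) ≫ p.2.1) (by simp [p.2.2])
      rw [e]
      simp⟩⟩

theorem IsRes.homotopy (h : IsRes K ε) (φ ψ : P ⟶ K) (e : φ.f 0 ≫ ε = ψ.f 0 ≫ ε) :
    Nonempty (Homotopy φ ψ) := by
  obtain ⟨H⟩ := h.homotopy_zero (φ - ψ) (by simp [e])
  exact ⟨Homotopy.equivSubZero.symm H⟩

end Lift

section Derived

variable {C D E A : Type*} [Category* C] [Category* D] [Category* E] [Category* A]
  [Abelian C] [Abelian D] [Abelian E] [Abelian A]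

/-- A natural transformation `T ∘ R ⟶ T'`. -/
structure Comparison (R : D ⥤ C) (T : C ⥤ A) (T' : D ⥤ A) where
  /-- the components -/
  app (Y : D) : T.obj (R.obj Y) ⟶ T'.obj Y
  naturality {Y Z : D} (f : Y ⟶ Z) : T.map (R.map f) ≫ app Z = app Y ≫ T'.map f

/-- A chain map `P ⟶ R(Q)`. -/
structure RelHom (R : D ⥤ C) (P : ChainComplex C ℕ) (Q : ChainComplex D ℕ) where
  /-- the components -/
  f (i : ℕ) : P.X i ⟶ R.obj (Q.X i)
  comm (i j : ℕ) : f i ≫ R.map (Q.d i j) = P.d i j ≫ f j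

/-- The chain map to the complex `R(Q)`. -/
def RelHom.hom {R : D ⥤ C} [R.Additive] {P : ChainComplex C ℕ} {Q : ChainComplex D ℕ}
    (φ : RelHom R P Q) : P ⟶ (R.mapHomologicalComplex _).obj Q where
  f := φ.f
  comm' i j _ := φ.comm i j

section
variable {R : D ⥤ C} [R.Additive] {T : C ⥤ A} [T.Additive]
  {T' : D ⥤ A} [T'.Additive] (α : Comparison R T T')

/-- `T(P) ⟶ T(R(Q)) ⟶ T'(Q)`, the first map being `T(φ)` and the second one `α`. -/
def chainComp {P : ChainComplex C ℕ} {Q : ChainComplex D ℕ} (φ : RelHom R P Q) :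
    (T.mapHomologicalComplex _).obj P ⟶ (T'.mapHomologicalComplex _).obj Q where
  f i := T.map (φ.f i) ≫ α.app (Q.X i)
  comm' i j _ := by
    have h : (T.map (φ.f i) ≫ α.app (Q.X i)) ≫ T'.map (Q.d i j) =
        T.map (P.d i j) ≫ T.map (φ.f j) ≫ α.app (Q.X j) := by
      rw [Category.assoc, ← α.naturality, ← T.map_comp_assoc, φ.comm, T.map_comp_assoc]
    exact h

/-- The chain map `T(R(Q)) ⟶ T'(Q)` given by `α`. -/
def chainMap (Q : ChainComplex D ℕ) :
    (T.mapHomologicalComplex _).obj ((R.mapHomologicalComplex (ComplexShape.down ℕ)).obj Q) ⟶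
      (T'.mapHomologicalComplex _).obj Q where
  f i := α.app (Q.X i)
  comm' i j _ := (α.naturality (Q.d i j)).symm

theorem chainComp_homology {P : ChainComplex C ℕ} {Q : ChainComplex D ℕ}
    {φ ψ : RelHom R P Q} (h : Homotopy φ.hom ψ.hom) (n : ℕ) :
    HomologicalComplex.homologyMap (chainComp α φ) n =
      HomologicalComplex.homologyMap (chainComp α ψ) n := by
  have e (φ : RelHom R P Q) : chainComp α φ =
      (T.mapHomologicalComplex _).map φ.hom ≫ chainMap α Q := by
    ext i
    rfl
  rw [e φ, e ψ, HomologicalComplex.homologyMap_comp, HomologicalComplex.homologyMap_comp,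
    (T.mapHomotopy h).homologyMap_eq]

variable [R.PreservesHomology]

theorem exists_resLift {X : C} {Y : D} (P : ProjectiveResolution X) (Q : ProjectiveResolution Y)
    (k : X ⟶ R.obj Y) : ∃ φ : RelHom R P.complex Q.complex,
      φ.f 0 ≫ R.map (aug Q) = aug P ≫ k := by
  obtain ⟨φ, h⟩ := ((isRes_aug Q).map R).exists_lift (isRes_aug P).w k
  exact ⟨⟨φ.f, fun i j => φ.comm i j⟩, h⟩

variable [HasProjectiveResolutions C] [HasProjectiveResolutions D]

/-- The map `(LₙT)(X) ⟶ (LₙT')(Y)` induced by `k : X ⟶ R(Y)` and `α : T ∘ R ⟶ T'`, where `R` is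
exact: lift `k` to a map `P ⟶ R(Q)`, where `P` and `Q` are projective resolutions of `X` and `Y`,
and take the homology of `T(P) ⟶ T(R(Q)) ⟶ T'(Q)`. The choice of the lift does not matter. -/
noncomputable def derivedMap {X : C} {Y : D} (k : X ⟶ R.obj Y) (n : ℕ) :
    (T.leftDerived n).obj X ⟶ (T'.leftDerived n).obj Y :=
  ((projectiveResolution X).isoLeftDerivedObj T n).hom ≫
    HomologicalComplex.homologyMap (chainComp α
      (exists_resLift (projectiveResolution X) (projectiveResolution Y) k).choose) n ≫
    ((projectiveResolution Y).isoLeftDerivedObj T' n).inv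

theorem derivedMap_eq {X : C} {Y : D} (k : X ⟶ R.obj Y) (n : ℕ)
    (φ : RelHom R (projectiveResolution X).complex (projectiveResolution Y).complex)
    (hφ : φ.f 0 ≫ R.map (aug (projectiveResolution Y)) = aug (projectiveResolution X) ≫ k) :
    derivedMap α k n = ((projectiveResolution X).isoLeftDerivedObj T n).hom ≫
      HomologicalComplex.homologyMap (chainComp α φ) n ≫
      ((projectiveResolution Y).isoLeftDerivedObj T' n).inv := by
  have hc := (exists_resLift (projectiveResolution X) (projectiveResolution Y) k).choose_spec
  obtain ⟨H⟩ := ((isRes_aug (projectiveResolution Y)).map R).homotopy (RelHom.hom _) φ.hom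
    (hc.trans hφ.symm)
  rw [derivedMap, chainComp_homology α H]

end

theorem iso_self_aux {A : Type*} [Category* A] {X Y : A} (i : X ≅ Y) : i.hom ≫ 𝟙 Y ≫ i.inv = 𝟙 X := by
  simp

theorem derivedMap_self [HasProjectiveResolutions C] {R : C ⥤ C} [R.Additive]
    [R.PreservesHomology] {T : C ⥤ A} [T.Additive] (α : Comparison R T T)
    (ρ : ∀ X, X ⟶ R.obj X) (hρ : ∀ {X Y : C} (f : X ⟶ Y), f ≫ ρ Y = ρ X ≫ R.map f)
    (h : ∀ X, T.map (ρ X) ≫ α.app X = 𝟙 (T.obj X)) (X : C) (n : ℕ) :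
    derivedMap α (ρ X) n = 𝟙 _ := by
  let φ : RelHom R (projectiveResolution X).complex (projectiveResolution X).complex :=
    { f := fun i => ρ _
      comm := fun i j => (hρ _).symm }
  rw [derivedMap_eq α (ρ X) n φ (hρ _).symm]
  have e : chainComp α φ = 𝟙 _ := by
    ext i
    exact h ((projectiveResolution X).complex.X i)
  rw [e, HomologicalComplex.homologyMap_id]
  exact iso_self_aux ((projectiveResolution X).isoLeftDerivedObj T n)

theorem comp_iso_aux {A : Type*} [Category* A] {X₀ X₁ X₂ X₃ X₄ Y : A} (a : X₀ ⟶ X₁) (b : X₁ ⟶ X₂) (c : X₂ ⟶ X₃)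
    (i : Y ≅ X₂) (d : X₃ ⟶ X₄) : a ≫ (b ≫ c) ≫ d = (a ≫ b ≫ i.inv) ≫ i.hom ≫ c ≫ d := by
  simp

theorem derivedMap_comp [HasProjectiveResolutions C] [HasProjectiveResolutions D]
    [HasProjectiveResolutions E] {R : D ⥤ C} [R.Additive] [R.PreservesHomology]
    {R' : E ⥤ D} [R'.Additive] [R'.PreservesHomology]
    {R'' : E ⥤ C} [R''.Additive] [R''.PreservesHomology]
    {T : C ⥤ A} [T.Additive] {T' : D ⥤ A} [T'.Additive] {T'' : E ⥤ A} [T''.Additive]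
    (α : Comparison R T T') (α' : Comparison R' T' T'') (α'' : Comparison R'' T T'')
    (ρ : ∀ W, R.obj (R'.obj W) ⟶ R''.obj W)
    (hρ : ∀ {W W' : E} (f : W ⟶ W'), R.map (R'.map f) ≫ ρ W' = ρ W ≫ R''.map f)
    (h : ∀ W : E, T.map (ρ W) ≫ α''.app W = α.app (R'.obj W) ≫ α'.app W)
    {X : C} {Y : D} {Z : E} (k : X ⟶ R.obj Y) (k' : Y ⟶ R'.obj Z) (k'' : X ⟶ R''.obj Z)
    (hk : k'' = k ≫ R.map k' ≫ ρ Z) (n : ℕ) :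
    derivedMap α'' k'' n = derivedMap α k n ≫ derivedMap α' k' n := by
  obtain ⟨φ, hφ⟩ := exists_resLift (projectiveResolution X) (projectiveResolution Y) k
  obtain ⟨ψ, hψ⟩ := exists_resLift (projectiveResolution Y) (projectiveResolution Z) k'
  let χ : RelHom R'' (projectiveResolution X).complex (projectiveResolution Z).complex :=
    { f := fun i => φ.f i ≫ R.map (ψ.f i) ≫ ρ _
      comm := fun i j => by
        rw [Category.assoc, Category.assoc, ← hρ, ← R.map_comp_assoc, ψ.comm, R.map_comp_assoc,
          reassoc_of% φ.comm] }
  rw [derivedMap_eq α k n φ hφ, derivedMap_eq α' k' n ψ hψ, derivedMap_eq α'' k'' n χ (by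
      change (φ.f 0 ≫ R.map (ψ.f 0) ≫ ρ _) ≫ R''.map (aug (projectiveResolution Z)) = _
      rw [Category.assoc, Category.assoc, ← hρ, ← R.map_comp_assoc, hψ, hk, R.map_comp_assoc,
        reassoc_of% hφ])]
  have e : chainComp α'' χ = chainComp α φ ≫ chainComp α' ψ := by
    ext i
    have e' : T.map (φ.f i ≫ R.map (ψ.f i) ≫ ρ _) ≫ α''.app _ =
        (T.map (φ.f i) ≫ α.app _) ≫ T'.map (ψ.f i) ≫ α'.app _ := by
      rw [T.map_comp_assoc, T.map_comp_assoc, h, ← Category.assoc (T.map (R.map _)), α.naturality]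
      simp only [Category.assoc]
    exact e'
  rw [e, HomologicalComplex.homologyMap_comp]
  exact comp_iso_aux _ _ _ ((projectiveResolution Y).isoLeftDerivedObj T' n) _

end Derived
/-- Presheaves of abelian groups on a poset. -/
abbrev PSh (P : Type u) [PartialOrder P] := Pᵒᵖ ⥤ AddCommGrpCat.{u}

/-- Copresheaves of abelian groups on a poset. -/
abbrev CoPSh (P : Type u) [PartialOrder P] := P ⥤ AddCommGrpCat.{u}

section Tensor

/-- Tensor product over `ℤ` of abelian groups. -/
noncomputable def tens (A B : AddCommGrpCat.{u}) : AddCommGrpCat.{u} :=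
  AddCommGrpCat.of (A ⊗[ℤ] B)

/-- The homomorphism `f ⊗ g`. -/
noncomputable def tensMap {A A' B B' : AddCommGrpCat.{u}} (f : A ⟶ A') (g : B ⟶ B') :
    tens A B ⟶ tens A' B' :=
  AddCommGrpCat.ofHom
    (TensorProduct.map f.hom.toIntLinearMap g.hom.toIntLinearMap).toAddMonoidHom

theorem tens_hom_ext {A B C : AddCommGrpCat.{u}} {f g : tens A B ⟶ C}
    (h : ∀ (a : A) (b : B), f.hom (a ⊗ₜ[ℤ] b) = g.hom (a ⊗ₜ[ℤ] b)) : f = g := by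
  ext z
  have : f.hom.toIntLinearMap = g.hom.toIntLinearMap := TensorProduct.ext' h
  exact DFunLike.congr_fun this z

@[simp]
theorem tensMap_tmul {A A' B B' : AddCommGrpCat.{u}} (f : A ⟶ A') (g : B ⟶ B')
    (a : A) (b : B) : (tensMap f g).hom (a ⊗ₜ[ℤ] b) = f.hom a ⊗ₜ[ℤ] g.hom b := rfl

theorem tensMap_id (A B : AddCommGrpCat.{u}) : tensMap (𝟙 A) (𝟙 B) = 𝟙 (tens A B) :=
  tens_hom_ext fun _ _ => rfl

theorem tensMap_comp {A A' A'' B B' B'' : AddCommGrpCat.{u}} (f : A ⟶ A') (f' : A' ⟶ A'')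
    (g : B ⟶ B') (g' : B' ⟶ B'') :
    tensMap (f ≫ f') (g ≫ g') = tensMap f g ≫ tensMap f' g' :=
  tens_hom_ext fun _ _ => rfl

theorem tensMap_add {A A' B B' : AddCommGrpCat.{u}} (f f' : A ⟶ A') (g : B ⟶ B') :
    tensMap (f + f') g = tensMap f g + tensMap f' g :=
  tens_hom_ext fun a b => TensorProduct.add_tmul (f.hom a) (f'.hom a) (g.hom b)

variable {P : Type u} [PartialOrder P]

/-- `⨁_{y ≤ x} F(x) ⊗ G(y)`; an index is a pair `(y, x)` with `y ≤ x`. -/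
noncomputable abbrev tensorSource (F : PSh P) (G : CoPSh P) : AddCommGrpCat.{u} :=
  ∐ fun i : {i : P × P // i.1 ≤ i.2} => tens (F.obj (op i.1.2)) (G.obj i.1.1)

/-- `⨁_p F(p) ⊗ G(p)`. -/
noncomputable abbrev tensorTarget (F : PSh P) (G : CoPSh P) : AddCommGrpCat.{u} :=
  ∐ fun p : P => tens (F.obj (op p)) (G.obj p)

/-- The map `F(y ≤ x) ⊗ 1`. -/
noncomputable def tensorLeft (F : PSh P) (G : CoPSh P) : tensorSource F G ⟶ tensorTarget F G :=
  Sigma.desc fun i => tensMap (F.map (homOfLE i.2).op) (𝟙 (G.obj i.1.1)) ≫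
    Sigma.ι (fun p : P => tens (F.obj (op p)) (G.obj p)) i.1.1

/-- The map `1 ⊗ G(y ≤ x)`. -/
noncomputable def tensorRight (F : PSh P) (G : CoPSh P) : tensorSource F G ⟶ tensorTarget F G :=
  Sigma.desc fun i => tensMap (𝟙 (F.obj (op i.1.2))) (G.map (homOfLE i.2)) ≫
    Sigma.ι (fun p : P => tens (F.obj (op p)) (G.obj p)) i.1.2

/-- The tensor product `F ⊗_P G` of functors. -/
noncomputable def tensorObj (F : PSh P) (G : CoPSh P) : AddCommGrpCat.{u} :=
  coequalizer (tensorLeft F G) (tensorRight F G)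

/-- The canonical map `F(p) ⊗ G(p) ⟶ F ⊗_P G`. -/
noncomputable def tensorι (F : PSh P) (G : CoPSh P) (p : P) :
    tens (F.obj (op p)) (G.obj p) ⟶ tensorObj F G :=
  Sigma.ι (fun p : P => tens (F.obj (op p)) (G.obj p)) p ≫
    coequalizer.π (tensorLeft F G) (tensorRight F G)

theorem tensorι_condition (F : PSh P) (G : CoPSh P) {y x : P} (h : y ≤ x) :
    tensMap (F.map (homOfLE h).op) (𝟙 (G.obj y)) ≫ tensorι F G y =
      tensMap (𝟙 (F.obj (op x))) (G.map (homOfLE h)) ≫ tensorι F G x := by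
  have e := Sigma.ι (fun i : {i : P × P // i.1 ≤ i.2} =>
    tens (F.obj (op i.1.2)) (G.obj i.1.1)) ⟨(y, x), h⟩ ≫=
      coequalizer.condition (tensorLeft F G) (tensorRight F G)
  simpa [tensorLeft, tensorRight, tensorι, tensorObj] using! e

theorem tensorObj_hom_ext {F : PSh P} {G : CoPSh P} {A : AddCommGrpCat.{u}}
    {f g : tensorObj F G ⟶ A} (h : ∀ p, tensorι F G p ≫ f = tensorι F G p ≫ g) : f = g := by
  have e (f' g' : coequalizer (tensorLeft F G) (tensorRight F G) ⟶ A)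
      (h' : ∀ p, (Sigma.ι (fun p : P => tens (F.obj (op p)) (G.obj p)) p ≫
        coequalizer.π (tensorLeft F G) (tensorRight F G)) ≫ f' =
          (Sigma.ι (fun p : P => tens (F.obj (op p)) (G.obj p)) p ≫
            coequalizer.π (tensorLeft F G) (tensorRight F G)) ≫ g') : f' = g' :=
    coequalizer.hom_ext (Sigma.hom_ext _ _ fun p => by simpa only [Category.assoc] using h' p)
  exact e f g h

/-- The universal property of `F ⊗_P G`. -/
noncomputable def tensorDesc {F : PSh P} {G : CoPSh P} {A : AddCommGrpCat.{u}}
    (φ : ∀ p, tens (F.obj (op p)) (G.obj p) ⟶ A)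
    (hφ : ∀ ⦃y x : P⦄ (h : y ≤ x), tensMap (F.map (homOfLE h).op) (𝟙 (G.obj y)) ≫ φ y =
      tensMap (𝟙 (F.obj (op x))) (G.map (homOfLE h)) ≫ φ x) : tensorObj F G ⟶ A :=
  coequalizer.desc (Sigma.desc φ) (by
    apply Sigma.hom_ext
    rintro ⟨⟨y, x⟩, h⟩
    simpa [tensorLeft, tensorRight] using hφ h)

theorem tensorι_desc {F : PSh P} {G : CoPSh P} {A : AddCommGrpCat.{u}}
    (φ : ∀ p, tens (F.obj (op p)) (G.obj p) ⟶ A)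
    (hφ : ∀ ⦃y x : P⦄ (h : y ≤ x), tensMap (F.map (homOfLE h).op) (𝟙 (G.obj y)) ≫ φ y =
      tensMap (𝟙 (F.obj (op x))) (G.map (homOfLE h)) ≫ φ x) (p : P) :
    tensorι F G p ≫ tensorDesc φ hφ = φ p := by
  have e (w) : (Sigma.ι (fun p : P => tens (F.obj (op p)) (G.obj p)) p ≫
      coequalizer.π (tensorLeft F G) (tensorRight F G)) ≫ coequalizer.desc (Sigma.desc φ) w =
        φ p := by
    rw [Category.assoc, coequalizer.π_desc, Sigma.ι_desc]
  exact e _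

end Tensor


section Maps
variable {P Q : Type u} [PartialOrder P] [PartialOrder Q]

/-- An `f`-homomorphism `F ⇝ E` of presheaves, for a monotone map `f : P → Q`. -/
@[ext]
structure FHom (f : P →o Q) (F : PSh P) (E : PSh Q) where
  /-- the components -/
  app (p : P) : F.obj (op p) ⟶ E.obj (op (f p))
  comm {y x : P} (h : y ≤ x) :
    F.map (homOfLE h).op ≫ app y = app x ≫ E.map (homOfLE (f.monotone h)).op

/-- An `f`-homomorphism `G ⇝ H` of copresheaves, for a monotone map `f : P → Q`. -/
structure CoFHom (f : P →o Q) (G : CoPSh P) (H : CoPSh Q) where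
  /-- the components -/
  app (p : P) : G.obj p ⟶ H.obj (f p)
  comm {y x : P} (h : y ≤ x) :
    G.map (homOfLE h) ≫ app x = app y ≫ H.map (homOfLE (f.monotone h))

/-- The map `F ⊗_P G ⟶ E ⊗_Q H` induced by `f`-homomorphisms `k : F ⇝ E` and `t : G ⇝ H`: it
sends the class of `a ⊗ b` over `p` to the class of `k(a) ⊗ t(b)` over `f(p)`. -/
noncomputable def tensorMap {f : P →o Q} {F : PSh P} {E : PSh Q} {G : CoPSh P} {H : CoPSh Q}
    (k : FHom f F E) (t : CoFHom f G H) : tensorObj F G ⟶ tensorObj E H :=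
  tensorDesc (fun p => tensMap (k.app p) (t.app p) ≫ tensorι E H (f p)) (by
    intro y x h
    have e := tensMap (k.app x) (t.app y) ≫= tensorι_condition E H (f.monotone h)
    rw [← Category.assoc, ← tensMap_comp, ← Category.assoc, ← tensMap_comp, Category.comp_id,
      Category.comp_id] at e
    rw [← Category.assoc, ← tensMap_comp, ← Category.assoc, ← tensMap_comp, Category.id_comp,
      Category.id_comp, k.comm, t.comm, e])

theorem tensorι_map {f : P →o Q} {F : PSh P} {E : PSh Q} {G : CoPSh P} {H : CoPSh Q}
    (k : FHom f F E) (t : CoFHom f G H) (p : P) :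
    tensorι F G p ≫ tensorMap k t = tensMap (k.app p) (t.app p) ≫ tensorι E H (f p) :=
  tensorι_desc _ _ p

theorem tensorι_map_assoc {f : P →o Q} {F : PSh P} {E : PSh Q} {G : CoPSh P} {H : CoPSh Q}
    (k : FHom f F E) (t : CoFHom f G H) (p : P) {A : AddCommGrpCat.{u}} (h : tensorObj E H ⟶ A) :
    tensorι F G p ≫ tensorMap k t ≫ h =
      tensMap (k.app p) (t.app p) ≫ tensorι E H (f p) ≫ h := by
  rw [← Category.assoc, tensorι_map, Category.assoc]

/-- The map `F ⊗_P G ⟶ F' ⊗_P G` induced by a morphism of presheaves. -/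
noncomputable def tensorHom {F F' : PSh P} (k : F ⟶ F') (G : CoPSh P) :
    tensorObj F G ⟶ tensorObj F' G :=
  tensorDesc (fun p => tensMap (k.app (op p)) (𝟙 (G.obj p)) ≫ tensorι F' G p) (by
    intro y x h
    have e := tensMap (k.app (op x)) (𝟙 (G.obj y)) ≫= tensorι_condition F' G h
    rw [← Category.assoc, ← tensMap_comp, ← Category.assoc, ← tensMap_comp, Category.comp_id,
      Category.comp_id, Category.id_comp] at e
    rw [← Category.assoc, ← tensMap_comp, ← Category.assoc, ← tensMap_comp, Category.id_comp,
      Category.id_comp, k.naturality, Category.comp_id, e])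

theorem tensorι_hom {F F' : PSh P} (k : F ⟶ F') (G : CoPSh P) (p : P) :
    tensorι F G p ≫ tensorHom k G = tensMap (k.app (op p)) (𝟙 (G.obj p)) ≫ tensorι F' G p :=
  tensorι_desc _ _ p

theorem tensorι_hom_assoc {F F' : PSh P} (k : F ⟶ F') (G : CoPSh P) (p : P)
    {A : AddCommGrpCat.{u}} (h : tensorObj F' G ⟶ A) :
    tensorι F G p ≫ tensorHom k G ≫ h =
      tensMap (k.app (op p)) (𝟙 (G.obj p)) ≫ tensorι F' G p ≫ h := by
  rw [← Category.assoc, tensorι_hom, Category.assoc]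

theorem tensorHom_add {F F' : PSh P} (k l : F ⟶ F') (G : CoPSh P) :
    tensorHom (k + l) G = tensorHom k G + tensorHom l G :=
  tensorObj_hom_ext fun p => by
    rw [Preadditive.comp_add, tensorι_hom, tensorι_hom, tensorι_hom, ← Preadditive.add_comp,
      ← tensMap_add]
    rfl

/-- The functor `- ⊗_P G`. -/
noncomputable def tensorWith (G : CoPSh P) : PSh P ⥤ AddCommGrpCat.{u} where
  obj F := tensorObj F G
  map k := tensorHom k G
  map_id F := tensorObj_hom_ext fun p => by
    rw [tensorι_hom, NatTrans.id_app, tensMap_id, Category.id_comp, Category.comp_id]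
  map_comp k l := tensorObj_hom_ext fun p => by
    rw [tensorι_hom, tensorι_hom_assoc, tensorι_hom, ← Category.assoc, ← tensMap_comp,
      NatTrans.comp_app, Category.comp_id]

instance (G : CoPSh P) : (tensorWith G).Additive where
  map_add := tensorHom_add _ _ G

/-- The pull-back `f^* : PSh(Q) ⥤ PSh(P)` along a monotone map `f : P → Q`. -/
abbrev pull (f : P →o Q) : PSh Q ⥤ PSh P :=
  (Functor.whiskeringLeft _ _ _).obj f.monotone.functor.op

/-- The pull-back `f^* G` of a copresheaf along a monotone map. -/
abbrev copull (f : P →o Q) : CoPSh Q ⥤ CoPSh P :=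
  (Functor.whiskeringLeft _ _ _).obj f.monotone.functor

end Maps

section Projectives
variable (P : Type u) [PartialOrder P]

/-- The presheaf that is free on one generator over `x`: `ℤ` on `{y | y ≤ x}`, zero elsewhere. -/
noncomputable def freeAt {P : Type u} [PartialOrder P] (x : P) : PSh P :=
  yoneda.obj x ⋙ AddCommGrpCat.free

/-- Morphisms out of `freeAt x` are elements over `x`. -/
noncomputable def freeAtEquiv {P : Type u} [PartialOrder P] (x : P) (F : PSh P) :
    (freeAt x ⟶ F) ≃ F.obj (op x) :=
  ((AddCommGrpCat.adj.{u}.whiskerRight Pᵒᵖ).homEquiv (yoneda.obj x) F).trans yonedaEquiv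

theorem freeAtEquiv_comp {P : Type u} [PartialOrder P] (x : P) {F F' : PSh P}
    (f : freeAt x ⟶ F) (k : F ⟶ F') :
    freeAtEquiv x F' (f ≫ k) = k.app (op x) (freeAtEquiv x F f) := by
  have e := (AddCommGrpCat.adj.{u}.whiskerRight Pᵒᵖ).homEquiv_naturality_right
    (X := yoneda.obj x) f k
  exact congrArg yonedaEquiv e

theorem freeAt_lift {P : Type u} [PartialOrder P] (x : P) {E X : PSh P} (f : freeAt x ⟶ X)
    (e : E ⟶ X) (h : Function.Surjective (e.app (op x))) : ∃ g, g ≫ e = f := by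
  obtain ⟨a, ha⟩ := h (freeAtEquiv x X f)
  refine ⟨(freeAtEquiv x E).symm a, (freeAtEquiv x X).injective ?_⟩
  rw [freeAtEquiv_comp, Equiv.apply_symm_apply, ha]

instance {P : Type u} [PartialOrder P] (x : P) : Projective (freeAt x) where
  factors f e he :=
    freeAt_lift x f e ((AddCommGrpCat.epi_iff_surjective _).1
      ((NatTrans.epi_iff_epi_app e).1 he (op x)))

instance : EnoughProjectives (PSh P) where
  presentation F := by
    let ι := Σ x : P, F.obj (op x)
    let π : (∐ fun i : ι => freeAt i.1) ⟶ F :=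
      Sigma.desc fun i => (freeAtEquiv i.1 F).symm i.2
    suffices h : Epi π from ⟨{ p := ∐ fun i : ι => freeAt i.1, f := π }⟩
    refine (NatTrans.epi_iff_epi_app π).2 fun x => ?_
    refine (AddCommGrpCat.epi_iff_surjective (π.app x)).2 fun a => ?_
    refine ⟨freeAtEquiv x.unop _ (Sigma.ι (fun i : ι => freeAt i.1) ⟨x.unop, a⟩), ?_⟩
    have e := freeAtEquiv_comp x.unop (Sigma.ι (fun i : ι => freeAt i.1) ⟨x.unop, a⟩) π
    rw [Sigma.ι_desc, Equiv.apply_symm_apply] at e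
    exact e.symm

end Projectives

section Tor
variable {P Q R : Type u} [PartialOrder P] [PartialOrder Q] [PartialOrder R]

/-- `Tor_n^P(F, G)`: the `n`-th left derived functor of `- ⊗_P G`, applied to `F`. -/
noncomputable def Tor (n : ℕ) (F : PSh P) (G : CoPSh P) : AddCommGrpCat.{u} :=
  ((tensorWith G).leftDerived n).obj F

instance (f : P →o Q) : (pull f).Additive where
  map_add := rfl

instance (f : P →o Q) : (pull f).PreservesHomology := inferInstance


/-- An `f`-homomorphism as a morphism `F ⟶ f^* E`. -/
def FHom.toPull {f : P →o Q} {F : PSh P} {E : PSh Q} (k : FHom f F E) : F ⟶ (pull f).obj E where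
  app p := k.app p.unop
  naturality _ _ h := k.comm (leOfHom h.unop)

/-- The canonical `f`-homomorphism `f^* E ⇝ E`. -/
def FHom.can (f : P →o Q) (E : PSh Q) : FHom f ((pull f).obj E) E where
  app p := 𝟙 (E.obj (op (f p)))
  comm _ := (Category.comp_id _).trans (Category.id_comp _).symm

theorem comm_paste {A : Type*} [Category* A] {a a' b b' c c' : A} {f : a ⟶ a'} {g : b ⟶ b'}
    {h : c ⟶ c'} {k : a ⟶ b} {k' : a' ⟶ b'} {l : b ⟶ c} {l' : b' ⟶ c'}
    (e : f ≫ k' = k ≫ g) (e' : g ≫ l' = l ≫ h) : f ≫ k' ≫ l' = (k ≫ l) ≫ h := by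
  rw [reassoc_of% e, e', Category.assoc]

/-- Composition of homomorphisms over monotone maps. -/
def FHom.comp {f : P →o Q} {g : Q →o R} {F : PSh P} {E : PSh Q} {D : PSh R}
    (k : FHom f F E) (l : FHom g E D) : FHom (g.comp f) F D where
  app p := k.app p ≫ l.app (f p)
  comm h := comm_paste (k.comm h) (l.comm (f.monotone h))

/-- Composition of homomorphisms over monotone maps. -/
def CoFHom.comp {f : P →o Q} {g : Q →o R} {G : CoPSh P} {H : CoPSh Q} {D : CoPSh R}
    (k : CoFHom f G H) (l : CoFHom g H D) : CoFHom (g.comp f) G D where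
  app p := k.app p ≫ l.app (f p)
  comm h := comm_paste (k.comm h) (l.comm (f.monotone h))

theorem tensorMap_comp {f : P →o Q} {g : Q →o R} {F : PSh P} {E : PSh Q} {D : PSh R}
    {G : CoPSh P} {H : CoPSh Q} {I : CoPSh R} (k : FHom f F E) (t : CoFHom f G H)
    (l : FHom g E D) (s : CoFHom g H I) :
    tensorMap k t ≫ tensorMap l s = tensorMap (k.comp l) (t.comp s) :=
  tensorObj_hom_ext fun p => by
    have e : tensMap (k.app p) (t.app p) ≫ tensMap (l.app (f p)) (s.app (f p)) ≫
        tensorι D I (g (f p)) = tensMap (k.app p ≫ l.app (f p)) (t.app p ≫ s.app (f p)) ≫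
          tensorι D I (g (f p)) := by
      rw [tensMap_comp, Category.assoc]
    rw [tensorι_map_assoc, tensorι_map, tensorι_map]
    exact e

theorem tensorHom_map {f : P →o Q} {F F' : PSh P} {E : PSh Q} {G : CoPSh P} {H : CoPSh Q}
    (k : F ⟶ F') (l : FHom f F' E) (m : FHom f F E) (t : CoFHom f G H)
    (h : ∀ p, k.app (op p) ≫ l.app p = m.app p) :
    tensorHom k G ≫ tensorMap l t = tensorMap m t :=
  tensorObj_hom_ext fun p => by
    rw [tensorι_hom_assoc, tensorι_map, tensorι_map, ← Category.assoc, ← tensMap_comp, h,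
      Category.id_comp]

theorem tensorMap_hom {f : P →o Q} {F : PSh P} {E E' : PSh Q} {G : CoPSh P} {H : CoPSh Q}
    (k : E ⟶ E') (l : FHom f F E) (m : FHom f F E') (t : CoFHom f G H)
    (h : ∀ p, l.app p ≫ k.app (op (f p)) = m.app p) :
    tensorMap l t ≫ tensorHom k H = tensorMap m t :=
  tensorObj_hom_ext fun p => by
    rw [tensorι_map_assoc, tensorι_hom, tensorι_map, ← Category.assoc, ← tensMap_comp, h,
      Category.comp_id]

theorem tensorMap_self {f : P →o P} (hf : ∀ p, f p ≤ p) {F : PSh P} {G : CoPSh P}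
    (m : FHom f F F) (hm : ∀ p, m.app p = F.map (homOfLE (hf p)).op) (t : CoFHom f G G)
    (ht : ∀ p, t.app p ≫ G.map (homOfLE (hf p)) = 𝟙 (G.obj p)) :
    tensorMap m t = 𝟙 (tensorObj F G) :=
  tensorObj_hom_ext fun p => by
    have e := tensMap (𝟙 (F.obj (op p))) (t.app p) ≫= tensorι_condition F G (hf p)
    rw [← Category.assoc, ← tensMap_comp, ← Category.assoc, ← tensMap_comp, Category.comp_id,
      Category.comp_id, Category.id_comp, ht, tensMap_id, Category.id_comp] at e
    rw [tensorι_map, hm, e, Category.comp_id]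

/-- The natural map `f^* E ⊗_P G ⟶ E ⊗_Q H` given by an `f`-homomorphism `t : G ⇝ H`. -/
noncomputable def tensorComparison {f : P →o Q} {G : CoPSh P} {H : CoPSh Q} (t : CoFHom f G H) :
    Comparison (pull f) (tensorWith G) (tensorWith H) where
  app E := tensorMap (FHom.can f E) t
  naturality {E E'} k :=
    (tensorHom_map ((pull f).map k) (FHom.can f E')
      ⟨fun p => k.app (op (f p)), fun h => k.naturality (homOfLE (f.monotone h)).op⟩ t
      fun _ => Category.comp_id _).trans
    (tensorMap_hom k (FHom.can f E)
      ⟨fun p => k.app (op (f p)), fun h => k.naturality (homOfLE (f.monotone h)).op⟩ t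
      fun _ => Category.id_comp _).symm

/-- The map `Tor_n^P(F, G) ⟶ Tor_n^Q(E, H)` induced by `f`-homomorphisms `k : F ⇝ E` and
`t : G ⇝ H`. -/
noncomputable def torMap {f : P →o Q} {F : PSh P} {E : PSh Q} {G : CoPSh P} {H : CoPSh Q}
    (k : FHom f F E) (t : CoFHom f G H) (n : ℕ) : Tor n F G ⟶ Tor n E H :=
  derivedMap (tensorComparison t) k.toPull n

theorem torMap_comp {f : P →o Q} {g : Q →o R} {F : PSh P} {E : PSh Q} {D : PSh R}
    {G : CoPSh P} {H : CoPSh Q} {I : CoPSh R} (k : FHom f F E) (t : CoFHom f G H)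
    (l : FHom g E D) (s : CoFHom g H I) (n : ℕ) :
    torMap (k.comp l) (t.comp s) n = torMap k t n ≫ torMap l s n := by
  refine derivedMap_comp (R := pull f) (R' := pull g) (R'' := pull (g.comp f))
    (tensorComparison t) (tensorComparison s) (tensorComparison (t.comp s))
    (fun W => 𝟙 ((pull (g.comp f)).obj W))
    (fun k => (Category.comp_id _).trans (Category.id_comp _).symm) (fun W => ?_)
    _ _ _ ?_ n
  · have e : tensorMap (FHom.can f ((pull g).obj W)) t ≫ tensorMap (FHom.can g W) s =
        tensorMap (FHom.can (g.comp f) W) (t.comp s) :=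
      (tensorMap_comp _ _ _ _).trans (congrArg (fun m => tensorMap m (t.comp s)) (by
        have : ∀ p, 𝟙 _ ≫ 𝟙 (W.obj (op (g (f p)))) = 𝟙 _ := fun p => Category.comp_id _
        exact FHom.ext (funext this)))
    have e' : (tensorWith G).map (𝟙 ((pull (g.comp f)).obj W)) ≫
        tensorMap (FHom.can (g.comp f) W) (t.comp s) =
          tensorMap (FHom.can (g.comp f) W) (t.comp s) := by
      rw [(tensorWith G).map_id]
      exact Category.id_comp _
    exact e'.trans e.symm
  · ext p : 2
    exact congrArg (k.app p.unop ≫ ·) (Category.comp_id (l.app (f p.unop))).symm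

/-- The constant copresheaf with value `ℤ`. -/
def constZ (P : Type u) [PartialOrder P] : CoPSh P :=
  (Functor.const P).obj (AddCommGrpCat.of (ULift.{u} ℤ))

/-- The identity of `ℤ`, as an `f`-homomorphism of constant copresheaves. -/
def constZHom (f : P →o Q) : CoFHom f (constZ P) (constZ Q) where
  app _ := 𝟙 _
  comm {_ _} _ := rfl

/-- `H_n(P; F)`, the homology of `P` with coefficients in `F`. -/
noncomputable def homology (n : ℕ) (F : PSh P) : AddCommGrpCat.{u} := Tor n F (constZ P)

/-- The map `H_n(P; F) ⟶ H_n(Q; E)` induced by an `f`-homomorphism `k : F ⇝ E`. -/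
noncomputable def homologyMap {f : P →o Q} {F : PSh P} {E : PSh Q} (k : FHom f F E) (n : ℕ) :
    homology n F ⟶ homology n E :=
  torMap k (constZHom f) n

theorem homologyMap_comp {f : P →o Q} {g : Q →o R} {F : PSh P} {E : PSh Q} {D : PSh R}
    (k : FHom f F E) (l : FHom g E D) (n : ℕ) :
    homologyMap (k.comp l) n = homologyMap k n ≫ homologyMap l n :=
  torMap_comp k (constZHom f) l (constZHom g) n

theorem map_square (F : PSh P) {a b c d : Pᵒᵖ} (f : a ⟶ b) (g : b ⟶ d) (f' : a ⟶ c)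
    (g' : c ⟶ d) : F.map f ≫ F.map g = F.map f' ≫ F.map g' := by
  rw [← F.map_comp, ← F.map_comp]
  rfl

theorem homologyMap_self {f : P →o P} (hf : ∀ p, f p ≤ p) {F : PSh P} (k : FHom f F F)
    (hk : ∀ p, k.app p = F.map (homOfLE (hf p)).op) (n : ℕ) :
    homologyMap k n = 𝟙 (homology n F) := by
  let ρ (E : PSh P) : E ⟶ (pull f).obj E :=
    { app := fun p => E.map (homOfLE (hf p.unop)).op
      naturality := fun p q h => map_square E _ _ _ _ }
  have e : k.toPull = ρ F := by
    ext p : 2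
    exact hk p.unop
  have := derivedMap_self (R := pull f) (tensorComparison (constZHom f)) ρ
    (fun {E E'} l => by
      ext p : 2
      exact (l.naturality (homOfLE (hf p.unop)).op).symm) (fun E => by
      exact (tensorHom_map (ρ E) (FHom.can f E)
        ⟨fun p => E.map (homOfLE (hf p)).op, fun _ => map_square E _ _ _ _⟩ (constZHom f)
        fun _ => Category.comp_id _).trans
          (tensorMap_self hf _ (fun _ => rfl) _ fun _ => Category.comp_id _)) F n
  rw [homologyMap, torMap, e]
  exact this

end Tor

section Fibration

variable {B : Type u} [PartialOrder B] (Ψ : Bᵒᵖ ⥤ PartOrd.{u})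

/-- The disjoint union `S = ⊔_{x ∈ B} Ψ(x)`, the total poset of the fibration given by `Ψ`. -/
@[ext]
structure Total where
  /-- the image in the base -/
  base : B
  /-- the point of the fibre -/
  pt : Ψ.obj (op base)

variable {Ψ}

/-- The monotone map `Ψ(x ≤ y) : Ψ(y) → Ψ(x)`. -/
def trans (Ψ : Bᵒᵖ ⥤ PartOrd.{u}) {x y : B} (h : x ≤ y) : Ψ.obj (op y) →o Ψ.obj (op x) :=
  (Ψ.map (homOfLE h).op).hom

theorem trans_self {x : B} (h : x ≤ x) (b : Ψ.obj (op x)) : trans Ψ h b = b := by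
  have : (homOfLE h).op = 𝟙 (op x) := rfl
  rw [trans, this, Ψ.map_id]
  rfl

theorem trans_comp {x y z : B} (h : x ≤ y) (h' : y ≤ z) :
    trans Ψ (h.trans h') = (trans Ψ h).comp (trans Ψ h') := by
  have : (homOfLE (h.trans h')).op = (homOfLE h').op ≫ (homOfLE h).op := rfl
  rw [trans, this, Ψ.map_comp]
  rfl

/-- `a ≤ b` iff `x ≤ y` and `a ≤ Ψ(x ≤ y)(b)` in `Ψ(x)`, for `a ∈ Ψ(x)` and `b ∈ Ψ(y)`. -/
instance : PartialOrder (Total Ψ) where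
  le a b := ∃ h : a.base ≤ b.base, a.pt ≤ trans Ψ h b.pt
  le_refl a := ⟨le_rfl, (trans_self le_rfl a.pt).ge⟩
  le_trans a b c := by
    rintro ⟨h, h1⟩ ⟨h', h2⟩
    refine ⟨h.trans h', h1.trans ?_⟩
    rw [trans_comp h h']
    exact (trans Ψ h).monotone h2
  le_antisymm a b := by
    obtain ⟨x, a⟩ := a
    obtain ⟨y, b⟩ := b
    rintro ⟨h, h1⟩ ⟨h', h2⟩
    obtain rfl : x = y := le_antisymm h h'
    dsimp only at h1 h2
    rw [trans_self] at h1 h2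
    rw [le_antisymm h1 h2]

/-- The projection `π : S → B`. -/
def proj (Ψ : Bᵒᵖ ⥤ PartOrd.{u}) : Total Ψ →o B where
  toFun := Total.base
  monotone' _ _ h := h.1

/-- The inclusion `Ψ(x) → S` of a fibre. -/
def incl (Ψ : Bᵒᵖ ⥤ PartOrd.{u}) (x : B) : Ψ.obj (op x) →o Total Ψ where
  toFun a := ⟨x, a⟩
  monotone' _ b h := ⟨le_rfl, h.trans (trans_self le_rfl b).ge⟩

theorem incl_trans_le {x y : B} (h : x ≤ y) (b : Ψ.obj (op y)) :
    incl Ψ x (trans Ψ h b) ≤ incl Ψ y b :=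
  ⟨h, le_rfl⟩

/-- The restriction `F|_{Ψ(x)}`. -/
abbrev fibre (F : PSh (Total Ψ)) (x : B) : PSh (Ψ.obj (op x)) := (pull (incl Ψ x)).obj F

/-- The `g`-homomorphism `F|_{Ψ(y)} ⇝ F|_{Ψ(x)}` given by the restriction maps `F(b) ⟶ F(g(b))`,
where `g : Ψ(y) → Ψ(x)` satisfies `g(b) ≤ b` in `S`. -/
def fibreHom (F : PSh (Total Ψ)) {x y : B} (g : Ψ.obj (op y) →o Ψ.obj (op x))
    (hg : ∀ b, incl Ψ x (g b) ≤ incl Ψ y b) : FHom g (fibre F y) (fibre F x) where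
  app b := F.map (homOfLE (hg b)).op
  comm _ := map_square F _ _ _ _

theorem fibreHom_comp (F : PSh (Total Ψ)) {x y z : B} (g : Ψ.obj (op y) →o Ψ.obj (op x))
    (hg : ∀ b, incl Ψ x (g b) ≤ incl Ψ y b) (g' : Ψ.obj (op z) →o Ψ.obj (op y))
    (hg' : ∀ b, incl Ψ y (g' b) ≤ incl Ψ z b) (g'' : Ψ.obj (op z) →o Ψ.obj (op x))
    (hg'' : ∀ b, incl Ψ x (g'' b) ≤ incl Ψ z b) (h : g'' = g.comp g') (n : ℕ) :
    homologyMap (fibreHom F g'' hg'') n =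
      homologyMap (fibreHom F g' hg') n ≫ homologyMap (fibreHom F g hg) n := by
  subst h
  rw [← homologyMap_comp]
  congr 1
  ext b : 2
  exact F.map_comp (homOfLE (hg' b)).op (homOfLE (hg (g' b))).op

/-- The presheaf `H_n(Ψ; F)` on `B`: its value at `x` is `H_n(Ψ(x); F|_{Ψ(x)})`, and its
restriction map from `y` to `x ≤ y` is induced by the restrictions `F(b) ⟶ F(Ψ(x ≤ y)(b))`. -/
noncomputable def fibreHomology (n : ℕ) (F : PSh (Total Ψ)) : PSh B where
  obj x := homology n (fibre F x.unop)
  map h := homologyMap (fibreHom F (trans Ψ (leOfHom h.unop)) (incl_trans_le _)) n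
  map_id _ := homologyMap_self (fun b => (trans_self le_rfl b).le) _ (fun _ => rfl) n
  map_comp h h' := fibreHom_comp F _ _ _ _ _ _ (trans_comp (leOfHom h'.unop) (leOfHom h.unop)) n

end Fibration

section Spectral

/-- A first quadrant spectral sequence of abelian groups that starts with the second page and has
differentials `d^r : E^r_{p,q} ⟶ E^r_{p+r-1,q-r}`. -/
abbrev SpecSeq := SpectralSequence AddCommGrpCat.{u}
  (fun r => ComplexShape.spectralSequenceNat (r - 1, -r)) 2

/-- `E` converges to `H`: every `H_n` has a filtration `0 = Φ_0 ≤ Φ_1 ≤ ⋯ ≤ Φ_{n+1} = H_n` with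
`E^∞_{p,q} ≅ Φ_{q+1} / Φ_q` whenever `p + q = n`. Here `E^∞_{p,q}` is `E^r_{p,q}` for any `r` so
large that no differential of `E^r` or of a later page can start or end at `(p,q)`, that is, for
`r ≥ p + 2` and `r ≥ q + 1`. -/
def Converges (E : SpecSeq.{u}) (H : ℕ → AddCommGrpCat.{u}) : Prop :=
  ∀ n : ℕ, ∃ Φ : ℕ → AddSubgroup (H n), Monotone Φ ∧ Φ 0 = ⊥ ∧ Φ (n + 1) = ⊤ ∧
    ∀ p q : ℕ, p + q = n → ∀ (r : ℤ) (hr : 2 ≤ r), (p : ℤ) + 2 ≤ r → (q : ℤ) + 1 ≤ r →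
      Nonempty ((E.page r hr).X (p, q) ≃+ Φ (q + 1) ⧸ (Φ q).addSubgroupOf (Φ (q + 1)))

end Spectral
end PosetTor

/-! The order on `S` makes `Ψ(x ≤ y)(b)` the largest element of `Ψ(x)` below `b ∈ Ψ(y)`. Hence the
left adjoint `π_!` of the pull-back `π^*` of presheaves is computed fibrewise: `(π_! F)(x)` is
`H_0(Ψ(x); F|_{Ψ(x)})` (`push`, `pushAdj`). It preserves projectives because `π^*` preserves
epimorphisms, and `F ⊗_S π^* G ≅ π_! F ⊗_B G` (`projectionFormula`) because both sides are left
adjoint to the same functor.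

Let `P` be a projective resolution of `F` and `K = π_! P`. By the projection formula, `K ⊗_B G`
computes `Tor^S(F, π^* G)` (`torPullIso`). Restriction to a fibre is exact, and it preserves
projectives because it has a right adjoint `coind` that preserves epimorphisms. So `P` restricts to
a projective resolution of `F|_{Ψ(x)}`, and the homology presheaf of `K` in degree `p` is `H_p(Ψ;
F)`, restriction maps included (`fibreHomologyIso`).

What remains is the hyper-`Tor` spectral sequence of a complex `K` of projectives
(`exists_hyperTor_specSeq`). Take a projective resolution `Q` of `G` and the double complex `K_p ⊗
Q_q`. Projectives are flat on either side (`tensorWith_exact`, `tensorLeftWith_exact`). Flatness of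
`K_p` shows that the total complex has the homology of `K ⊗ G`. Filter it by `q`: flatness of `Q_q`
turns the homology in the `p`-direction into `H_p(K) ⊗ Q_q`, so the second page is `H_q(H_p(K) ⊗
Q)`, which is `Tor_q(H_p(K), G)` because `Tor` is balanced (`tor_equiv_right`). The pages themselves
are the subquotients `Z^r / B^r` of a filtered differential group (`FiltDiff.page_iso`,
`FiltDiff.converges`). -/

namespace PosetTor

/-! ### Homology of complexes of abelian groups, in terms of elements -/

section HomologyOfAb

/-- A description of the homology of a short complex of abelian groups. -/
theorem homology_equiv_quotient (S : ShortComplex AddCommGrpCat.{u}) {Z : Type*} [AddCommGroup Z]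
    (B : AddSubgroup Z) (φ : Z →+ S.X₂) (h0 : ∀ z, S.g.hom (φ z) = 0)
    (hs : ∀ x, S.g.hom x = 0 → ∃ z y, x = φ z + S.f.hom y)
    (hk : ∀ z, z ∈ B ↔ ∃ y, S.f.hom y = φ z) : Nonempty (S.homology ≃+ Z ⧸ B) := by
  let ψ : Z →+ AddMonoidHom.ker S.g.hom ⧸ AddMonoidHom.range S.abToCycles :=
    (QuotientAddGroup.mk' _).comp (φ.codRestrict (AddMonoidHom.ker S.g.hom) h0)
  have hψ : Function.Surjective ψ := by
    intro c
    obtain ⟨⟨x, hx⟩, rfl⟩ := QuotientAddGroup.mk_surjective c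
    obtain ⟨z, y, e⟩ := hs x hx
    refine ⟨z, (QuotientAddGroup.eq).2 ⟨y, Subtype.ext ?_⟩⟩
    change S.f.hom y = -φ z + x
    rw [e, neg_add_cancel_left]
  have hker : B = ψ.ker := by
    ext z
    rw [hk, AddMonoidHom.mem_ker]
    change _ ↔ QuotientAddGroup.mk _ = _
    rw [QuotientAddGroup.eq_zero_iff]
    exact ⟨fun ⟨y, e⟩ => ⟨y, Subtype.ext e⟩, fun ⟨y, e⟩ => ⟨y, congrArg Subtype.val e⟩⟩
  exact ⟨(S.abHomologyIso.addCommGroupIsoToAddEquiv).trans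
    ((QuotientAddGroup.quotientAddEquivOfEq hker).trans
      (QuotientAddGroup.quotientKerEquivOfSurjective ψ hψ)).symm⟩

/-- A description of the homology of a complex of abelian groups. -/
theorem homologicalComplex_homology_equiv {ι : Type*} {c : ComplexShape ι}
    (K : HomologicalComplex AddCommGrpCat.{u} c) (i : ι) {Z : Type*} [AddCommGroup Z]
    (B : AddSubgroup Z) (φ : Z →+ K.X i) (h0 : ∀ z j, c.Rel i j → (K.d i j).hom (φ z) = 0)
    (hs : ∀ x, (∀ j, c.Rel i j → (K.d i j).hom x = 0) →
      ∃ (z : Z) (k : ι) (y : K.X k), x = φ z + (K.d k i).hom y)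
    (hB : ∀ z ∈ B, ∃ (k : ι) (y : K.X k), (K.d k i).hom y = φ z)
    (hB' : ∀ (z : Z) (k : ι) (y : K.X k), c.Rel k i → (K.d k i).hom y = φ z → z ∈ B)
    (hB0 : ∀ z, φ z = 0 → z ∈ B) : Nonempty (K.homology i ≃+ Z ⧸ B) := by
  -- At an edge of the complex, `c.next i` or `c.prev i` is a default index unrelated to `i`. The
  -- differential there is zero, which `hd` and `him` use to pass between these indices and the ones
  -- in the hypotheses.
  have hd (j) (x : K.X i) (h : c.Rel i j → (K.d i j).hom x = 0) : (K.d i j).hom x = 0 := by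
    by_cases hr : c.Rel i j
    · exact h hr
    · rw [K.shape _ _ hr]
      rfl
  have him (k) (y : K.X k) : ∃ y' : K.X (c.prev i), (K.d _ i).hom y' = (K.d k i).hom y := by
    by_cases hr : c.Rel k i
    · obtain rfl := c.prev_eq' hr
      exact ⟨y, rfl⟩
    · rw [K.shape _ _ hr]
      exact ⟨0, map_zero _⟩
  refine homology_equiv_quotient (K.sc i) B φ (fun z => hd _ _ (h0 z _)) (fun x hx => ?_)
    fun z => ⟨fun hz => ?_, fun ⟨y, hy⟩ => ?_⟩
  · obtain ⟨z, k, y, e⟩ := hs x (fun j hj => by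
      obtain rfl := c.next_eq' hj
      exact hx)
    obtain ⟨y', e'⟩ := him k y
    exact ⟨z, y', by rw [e, ← e']; rfl⟩
  · obtain ⟨k, y, e⟩ := hB z hz
    obtain ⟨y', e'⟩ := him k y
    exact ⟨y', e'.trans e⟩
  · by_cases hr : c.Rel (c.prev i) i
    · exact hB' z _ y hr hy
    -- No differential ends at `i`, so `φ z` is a boundary only when it is zero.
    · refine hB0 z (hy.symm.trans ?_)
      change (K.d (c.prev i) i).hom y = 0
      rw [K.shape _ _ hr]
      rfl

end HomologyOfAb

/-! ### The spectral sequence of a filtered differential group -/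

/-- A filtered differential abelian group: `A n q` is the part of degree `n` and filtration
degree at most `q`. The filtration is bounded in a first-quadrant fashion. -/
structure FiltDiff where
  /-- the underlying group -/
  K : Type u
  [grp : AddCommGroup K]
  /-- the differential -/
  d : K →+ K
  d_d (x : K) : d (d x) = 0
  /-- the filtration -/
  A : ℤ → ℤ → AddSubgroup K
  mono (n : ℤ) {q q' : ℤ} (h : q ≤ q') : A n q ≤ A n q'
  d_mem {n q : ℤ} {x : K} (h : x ∈ A n q) : d x ∈ A (n - 1) q
  bot {n q : ℤ} (h : q < 0) {x : K} (hx : x ∈ A n q) : x = 0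
  top (n q : ℤ) : A n q ≤ A n n

namespace FiltDiff

attribute [instance] FiltDiff.grp

variable (D : FiltDiff.{u})

/-- Elements of filtration degree `q` with boundary of filtration degree `q - r`. -/
def Z (r n q : ℤ) : AddSubgroup D.K := D.A n q ⊓ (D.A (n - 1) (q - r)).comap D.d

/-- The denominator of the `r`-th page. -/
def Bd (r n q : ℤ) : AddSubgroup D.K :=
  D.Z (r - 1) n (q - 1) ⊔ (D.Z (r - 1) (n + 1) (q + r - 1)).map D.d

/-- The entries of the `r`-th page. -/
abbrev E (r n q : ℤ) : Type u := D.Z r n q ⧸ (D.Bd r n q).addSubgroupOf (D.Z r n q)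

variable {D}

theorem mem_Z {r n q : ℤ} {x : D.K} : x ∈ D.Z r n q ↔ x ∈ D.A n q ∧ D.d x ∈ D.A (n - 1) (q - r) :=
  Iff.rfl

theorem mem_Bd {r n q : ℤ} {x : D.K} : x ∈ D.Bd r n q ↔
    ∃ y ∈ D.Z (r - 1) n (q - 1), ∃ w ∈ D.Z (r - 1) (n + 1) (q + r - 1), y + D.d w = x := by
  simp [Bd, AddSubgroup.mem_sup]

theorem mem_Z_of_cycle {r n q : ℤ} {x : D.K} (hx : x ∈ D.A n q) (h : D.d x = 0) : x ∈ D.Z r n q :=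
  mem_Z.2 ⟨hx, h ▸ zero_mem _⟩

theorem mem_Z_of_le {r r' n q q' : ℤ} {x : D.K} (hx : x ∈ D.Z r n q) (h : q ≤ q')
    (h' : q - r ≤ q' - r') : x ∈ D.Z r' n q' :=
  mem_Z.2 ⟨D.mono _ h hx.1, D.mono _ h' hx.2⟩

theorem d_mem_Z {r n q n' q' : ℤ} (hn : n' + 1 = n) (hq : q' + r = q) {x : D.K}
    (hx : x ∈ D.Z r n q) : D.d x ∈ D.Z r n' q' := by
  obtain rfl : n' = n - 1 := by lia
  obtain rfl : q' = q - r := by lia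
  exact mem_Z_of_cycle hx.2 (D.d_d x)

/-- The boundary part of the denominator is killed by `d`. The part of lower filtration is carried
into the boundary part of the target, since `q - 1 = q' + r - 1`. -/
theorem d_mem_Bd {r n q n' q' : ℤ} (hn : n' + 1 = n) (hq : q' + r = q) {x : D.K}
    (hx : x ∈ D.Bd r n q) : D.d x ∈ D.Bd r n' q' := by
  subst hn hq
  obtain ⟨y, hy, w, hw, rfl⟩ := mem_Bd.1 hx
  rw [map_add, D.d_d, add_zero]
  refine mem_Bd.2 ⟨0, zero_mem _, y, ?_, zero_add _⟩
  exact hy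

/-- The differential of the `r`-th page. -/
def dE {r n q n' q' : ℤ} (hn : n' + 1 = n) (hq : q' + r = q) : D.E r n q →+ D.E r n' q' :=
  QuotientAddGroup.map _ _ ((D.d.comp (D.Z r n q).subtype).codRestrict (D.Z r n' q')
    fun x => d_mem_Z hn hq x.2) fun _ hx => d_mem_Bd hn hq hx

variable (D) in
/-- The `r`-th page. -/
noncomputable def page (r : ℤ) :
    HomologicalComplex AddCommGrpCat.{u} (ComplexShape.spectralSequenceNat (r - 1, -r)) where
  X a := AddCommGrpCat.of (D.E r (a.1 + a.2) a.2)
  d a b := open Classical in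
    if h : (ComplexShape.spectralSequenceNat (r - 1, -r)).Rel a b then
      AddCommGrpCat.ofHom (dE (by have := h.1; have := h.2; lia) (by have := h.2; lia)) else 0
  shape a b h := dif_neg h
  d_comp_d' a b c h h' := by
    rw [dif_pos h, dif_pos h']
    refine AddCommGrpCat.hom_ext (AddMonoidHom.ext fun x => ?_)
    induction x using QuotientAddGroup.induction_on with
    | H x => exact congrArg QuotientAddGroup.mk (Subtype.ext (D.d_d x.1))

theorem page_d {r : ℤ} {a b : ℕ × ℕ} (h : (ComplexShape.spectralSequenceNat (r - 1, -r)).Rel a b)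
    (x : D.Z r (a.1 + a.2) a.2) : ∃ h', ((D.page r).d a b).hom (QuotientAddGroup.mk x) =
      (QuotientAddGroup.mk ⟨D.d x.1, h'⟩ : D.E r (b.1 + b.2) b.2) := by
  refine ⟨d_mem_Z (by have := h.1; have := h.2; lia) (by have := h.2; lia) x.2, ?_⟩
  simp only [page]
  rw [dif_pos h]
  rfl

theorem mk_eq_mk {r n q : ℤ} {x y : D.Z r n q} :
    (QuotientAddGroup.mk x : D.E r n q) = QuotientAddGroup.mk y ↔ (x.1 - y.1) ∈ D.Bd r n q := by
  rw [eq_comm, QuotientAddGroup.eq, AddSubgroup.mem_addSubgroupOf]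
  simp [sub_eq_add_neg, add_comm]

theorem mk_eq_zero {r n q : ℤ} {x : D.Z r n q} :
    (QuotientAddGroup.mk x : D.E r n q) = 0 ↔ x.1 ∈ D.Bd r n q :=
  QuotientAddGroup.eq_zero_iff x

/-- Elements that survive to the next page. -/
def survivor (r n q : ℤ) : D.Z (r + 1) n q →+ D.E r n q :=
  (QuotientAddGroup.mk' _).comp
    (AddSubgroup.inclusion fun _ hx => mem_Z_of_le hx le_rfl (by lia))

/-- A class is a cycle of `d^r` exactly when it has a representative in `Z (r + 1)`: a correction in
`Z (r - 1)` of filtration `q - 1` pushes the boundary one filtration step deeper. Likewise the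
boundaries of `d^r` account for the growth of the denominator. Where the quadrant cuts off a
differential, the bounds `bot` and `top` of the filtration replace it. -/
theorem page_iso {r r' : ℤ} (hr : r + 1 = r') (hr2 : 2 ≤ r) (a : ℕ × ℕ) :
    Nonempty ((D.page r).homology a ≃+ D.E r' (a.1 + a.2) a.2) := by
  subst hr
  obtain ⟨p, q⟩ := a
  refine homologicalComplex_homology_equiv (D.page r) (p, q) _ (survivor r (p + q) q) ?_ ?_ ?_ ?_ ?_
  · rintro ⟨z, hz⟩ ⟨p', q'⟩ h
    obtain ⟨h', e⟩ := page_d h ⟨z, mem_Z_of_le hz le_rfl (by lia)⟩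
    refine e.trans (mk_eq_zero.2 ?_)
    have h1 := h.1
    have h2 := h.2
    dsimp only at h1 h2
    refine mem_Bd.2 ⟨D.d z, mem_Z_of_cycle ?_ (D.d_d z), 0, zero_mem _, by simp⟩
    convert! (mem_Z.1 hz).2 using 2 <;> dsimp <;> lia
  · intro x hx
    obtain ⟨⟨x, hxZ⟩, rfl⟩ := QuotientAddGroup.mk_surjective x
    dsimp only at hxZ
    -- `x` differs from an element of `Z (r + 1)` by an element of lower filtration
    obtain ⟨y, hy, hxy⟩ : ∃ y ∈ D.Z (r - 1) (p + q) (q - 1), x - y ∈ D.Z (r + 1) (p + q) q := by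
      by_cases hq : r ≤ q
      · have hrel : (ComplexShape.spectralSequenceNat (r - 1, -r)).Rel (p, q)
            ((p + r - 1).toNat, (q - r).toNat) := by
          constructor <;> dsimp <;> lia
        obtain ⟨h', e⟩ := page_d hrel ⟨x, hxZ⟩
        -- Vanishing of `d^r` means `d x = y + d w`, where `w` has filtration `q - 1` and `y` has
        -- filtration `q - r - 1`. So `x - w` has boundary `y` and survives.
        have := mk_eq_zero.1 (e.symm.trans (hx _ hrel))
        obtain ⟨y, hy, w, hw, e⟩ := mem_Bd.1 this
        dsimp only at hy hw e
        have e1 : (((p + r - 1).toNat : ℕ) : ℤ) + ((q - r).toNat : ℕ) = p + q - 1 := by lia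
        have e2 : (((q - r).toNat : ℕ) : ℤ) = q - r := by lia
        rw [e1, e2] at hy hw
        have hw' : w ∈ D.Z (r - 1) (p + q) (q - 1) := by
          convert hw using 2 <;> lia
        refine ⟨w, hw', mem_Z.2 ⟨sub_mem (S := AddSubgroup D.K) hxZ.1
          (D.mono _ (by lia) hw'.1), ?_⟩⟩
        have : D.d (x - w) = y := by rw [map_sub, sub_eq_iff_eq_add]; exact e.symm
        rw [this]
        convert (mem_Z.1 hy).1 using 2
        lia
      -- Here `q - r < 0`, so `x` is already a cycle.
      · refine ⟨0, zero_mem _, ?_⟩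
        rw [sub_zero]
        exact mem_Z_of_cycle hxZ.1 (D.bot (by lia) hxZ.2)
    refine ⟨⟨x - y, hxy⟩, (p, q), 0, ?_⟩
    rw [map_zero, add_zero]
    refine (mk_eq_mk (y := ⟨x - y, mem_Z_of_le hxy le_rfl (by lia)⟩)).2 ?_
    refine mem_Bd.2 ⟨y, hy, 0, zero_mem _, ?_⟩
    simp
  · rintro ⟨z, hz⟩ hzB
    obtain ⟨y, hy, w, hw, e⟩ := mem_Bd.1 hzB
    change y + D.d w = z at e
    dsimp only at hy hw
    rw [show r + 1 - 1 = r by lia] at hy hw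
    rw [show (q : ℤ) + (r + 1) - 1 = q + r by lia] at hw
    by_cases hp : r - 1 ≤ p
    · have hrel : (ComplexShape.spectralSequenceNat (r - 1, -r)).Rel
          ((p - r + 1).toNat, (q + r).toNat) (p, q) := by
        constructor <;> dsimp <;> lia
      have hw' : w ∈ D.Z r (((p - r + 1).toNat : ℕ) + ((q + r).toNat : ℕ)) ((q + r).toNat : ℕ) := by
        convert hw using 2 <;> lia
      refine ⟨((p - r + 1).toNat, (q + r).toNat), QuotientAddGroup.mk ⟨w, hw'⟩, ?_⟩
      obtain ⟨h', e'⟩ := page_d hrel ⟨w, hw'⟩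
      refine e'.trans (mk_eq_mk.2 (mem_Bd.2 ⟨-y, ?_, 0, zero_mem _, ?_⟩))
      · exact neg_mem (mem_Z_of_le hy le_rfl (by dsimp; lia))
      · simp [← e]
    -- No differential of the page ends at `(p, q)`. Since `p + q + 1 ≤ q + r - 1`, the element `w`
    -- already lies in the filtration step allowed on page `r`, so `z` represents zero there; the
    -- source index of the boundary `0` is immaterial.
    · refine ⟨(p, q), 0, ?_⟩
      rw [map_zero]
      refine ((mk_eq_zero (x := ⟨z, mem_Z_of_le hz le_rfl (by lia)⟩)).2 (mem_Bd.2 ⟨y, mem_Z_of_le hy le_rfl (by lia), w, ?_, e⟩)).symm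
      exact mem_Z.2 ⟨D.mono _ (by lia) (D.top _ _ hw.1), D.mono _ (by lia) hw.2⟩
  · rintro ⟨z, hz⟩ ⟨p', q'⟩ y hrel e
    obtain ⟨⟨y, hy⟩, rfl⟩ := QuotientAddGroup.mk_surjective y
    obtain ⟨h', e'⟩ := page_d hrel ⟨y, hy⟩
    obtain ⟨v, hv, w, hw, e⟩ := mem_Bd.1 (mk_eq_mk.1 (e'.symm.trans e))
    have h1 := hrel.1
    have h2 := hrel.2
    dsimp only at hv hw hy hz h1 h2
    change v + D.d w = D.d y - z at e
    -- This exhibits `z` in the next denominator. Applying `d` gives `d v = -d z`, which lies one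
    -- filtration step deeper than `v ∈ Z (r - 1)` guarantees.
    have ez : z = -v + D.d (y - w) := by
      rw [map_sub, sub_eq_iff_eq_add.1 e.symm]
      abel
    have hyw : y - w ∈ D.Z r (p + q + 1) (q + r) := by
      refine sub_mem ?_ (mem_Z_of_le hw (by lia) (by lia))
      convert hy using 2 <;> lia
    refine mem_Bd.2 ⟨-v, neg_mem (mem_Z.2 ⟨hv.1, ?_⟩), y - w, ?_, ez.symm⟩
    · have : D.d v = - D.d z := by rw [ez, map_add, map_neg, D.d_d]; simp
      rw [this]
      exact neg_mem (D.mono _ (by dsimp; lia) (mem_Z.1 hz).2)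
    · convert hyw using 2 <;> lia
  · rintro ⟨z, hz⟩ e
    obtain ⟨v, hv, w, hw, e⟩ := mem_Bd.1
      ((mk_eq_zero (x := ⟨z, mem_Z_of_le hz le_rfl (by lia)⟩)).1 e)
    dsimp only at hv hw hz
    change v + D.d w = z at e
    refine mem_Bd.2 ⟨v, mem_Z.2 ⟨hv.1, ?_⟩, w, mem_Z_of_le hw (by lia) (by lia), e⟩
    have : D.d v = D.d z := by rw [← e, map_add, D.d_d, add_zero]
    rw [this]
    exact D.mono _ (by dsimp; lia) (mem_Z.1 hz).2

variable (D) in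
/-- The spectral sequence of a filtered differential group. -/
noncomputable def specSeq : SpecSeq.{u} where
  page r _ := D.page r
  iso _ _ a h hr := (page_iso h hr a).some.toAddCommGrpIso

variable (D)

/-- The cycles of degree `n`. -/
def cyc (n : ℤ) : AddSubgroup D.K := D.A n n ⊓ D.d.ker

variable {D} in
theorem mem_cyc {n : ℤ} {x : D.K} : x ∈ D.cyc n ↔ x ∈ D.A n n ∧ D.d x = 0 := Iff.rfl

/-- The boundaries of degree `n`. -/
def bdry (n : ℤ) : AddSubgroup D.K := (D.A (n + 1) (n + 1)).map D.d

/-- The homology in degree `n`. -/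
abbrev H (n : ℤ) : Type u := D.cyc n ⧸ (D.bdry n).addSubgroupOf (D.cyc n)

/-- For `r ≥ q + 1` every element of `Z r` is a cycle, as its boundary has negative filtration. For
`r ≥ p + 2` all elements of degree `n + 1` have filtration at most `q + r - 1`, so the denominator
contains every boundary of filtration `q`. What remains is cycles of filtration `q` modulo those of
filtration `q - 1` and boundaries. -/
theorem converges (H : ℕ → AddCommGrpCat.{u}) (e : ∀ n : ℕ, Nonempty (H n ≃+ D.H n)) :
    Converges D.specSeq H := by
  intro n
  obtain ⟨e⟩ := e n
  let ρ : D.cyc n →+ H n := e.symm.toAddMonoidHom.comp (QuotientAddGroup.mk' _)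
  have hρ : Function.Surjective ρ := e.symm.surjective.comp QuotientAddGroup.mk_surjective
  have hρ0 (x) : ρ x = 0 ↔ x.1 ∈ D.bdry n := by
    change e.symm _ = 0 ↔ _
    rw [e.symm.map_eq_zero_iff]
    exact QuotientAddGroup.eq_zero_iff _
  -- The filtration degree is shifted by one so that `Φ 0` comes from degree `-1` and vanishes.
  let Φ (q : ℕ) : AddSubgroup (H n) := ((D.A n ((q : ℤ) - 1)).addSubgroupOf (D.cyc n)).map ρ
  refine ⟨Φ, fun q q' h => ?_, ?_, ?_, ?_⟩
  · refine AddSubgroup.map_mono fun x (hx : x.1 ∈ D.A n ((q : ℤ) - 1)) => ?_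
    exact D.mono _ (by lia) hx
  · rw [eq_bot_iff]
    rintro _ ⟨x, hx, rfl⟩
    have : x = 0 := Subtype.ext (D.bot (by lia) hx)
    rw [this, map_zero]
    exact zero_mem _
  · rw [eq_top_iff]
    intro y _
    obtain ⟨x, rfl⟩ := hρ y
    refine ⟨x, ?_, rfl⟩
    exact D.mono _ (by lia) x.2.1
  · intro p q hpq r hr hp hq
    have hcyc {x} (hx : x ∈ D.Z r n q) : D.d x = 0 := D.bot (by lia) hx.2
    let ψ : D.Z r n q →+ Φ (q + 1) := (ρ.comp (AddSubgroup.inclusion fun x (hx : x ∈ D.Z r n q) =>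
      ⟨D.top _ _ hx.1, hcyc hx⟩)).codRestrict _ fun x => ⟨_, by
        have := x.2.1
        exact D.mono _ (by lia) this, rfl⟩
    let χ : D.Z r n q →+ Φ (q + 1) ⧸ (Φ q).addSubgroupOf (Φ (q + 1)) :=
      (QuotientAddGroup.mk' _).comp ψ
    have hχ : Function.Surjective χ := by
      intro c
      obtain ⟨⟨_, x, hx, rfl⟩, rfl⟩ := QuotientAddGroup.mk_surjective c
      exact ⟨⟨x.1, mem_Z_of_cycle (D.mono _ (by lia) hx) x.2.2⟩, rfl⟩
    have hker : (D.Bd r n q).addSubgroupOf (D.Z r n q) = χ.ker := by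
      ext x
      rw [AddMonoidHom.mem_ker, AddSubgroup.mem_addSubgroupOf]
      change _ ↔ QuotientAddGroup.mk _ = _
      rw [QuotientAddGroup.eq_zero_iff, AddSubgroup.mem_addSubgroupOf]
      constructor
      · intro h
        obtain ⟨y, hy, w, hw, e⟩ := mem_Bd.1 h
        have hy0 : D.d y = 0 := by
          have := hcyc x.2
          rwa [← e, map_add, D.d_d, add_zero] at this
        refine ⟨⟨y, D.top _ _ hy.1, hy0⟩, ?_, ?_⟩
        · exact D.mono _ (by lia) hy.1
        · rw [← sub_eq_zero]
          refine (map_sub ρ _ _).symm.trans ((hρ0 _).2 ⟨-w, neg_mem (D.top _ _ hw.1), ?_⟩)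
          change D.d (-w) = y - x.1
          rw [← e]
          simp
      · rintro ⟨y, hy, e⟩
        obtain ⟨w, hw, e⟩ := (hρ0 _).1 ((map_sub ρ _ _).trans (sub_eq_zero.2 e))
        change D.d w = y.1 - x.1 at e
        have hd0 : D.d y.1 = 0 := y.2.2
        refine mem_Bd.2 ⟨y.1, mem_Z_of_cycle (D.mono _ (by lia) hy) hd0, -w,
          neg_mem (mem_Z.2 ⟨D.mono _ (by lia) hw, ?_⟩), ?_⟩
        · rw [e]
          have h1 : y.1 - x.1 ∈ D.A n q := sub_mem (D.mono n (by lia) hy) x.2.1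
          convert h1 using 2 <;> lia
        · rw [map_neg, e]
          simp
    have : Nonempty (D.E r (p + q) q ≃+ Φ (q + 1) ⧸ (Φ q).addSubgroupOf (Φ (q + 1))) := by
      have hn : (p : ℤ) + q = n := by lia
      rw [hn]
      exact ⟨(QuotientAddGroup.quotientAddEquivOfEq hker).trans
        (QuotientAddGroup.quotientKerEquivOfSurjective χ hχ)⟩
    exact this

end FiltDiff

/-! ### Double complexes and their total complexes -/

/-- A first-quadrant double complex of abelian groups with anticommuting squares. -/
structure DoubleCx where
  /-- the entries -/
  M : ℕ → ℕ → Type u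
  [grp : ∀ p q, AddCommGroup (M p q)]
  /-- the first differential -/
  v (p q : ℕ) : M (p + 1) q →+ M p q
  /-- the second differential -/
  h (p q : ℕ) : M p (q + 1) →+ M p q
  v_v (p q : ℕ) (x : M (p + 2) q) : v p q (v (p + 1) q x) = 0
  h_h (p q : ℕ) (x : M p (q + 2)) : h p q (h p (q + 1) x) = 0
  anti (p q : ℕ) (x : M (p + 1) (q + 1)) : v p q (h (p + 1) q x) + h p q (v p (q + 1) x) = 0

namespace DoubleCx

attribute [instance] DoubleCx.grp

variable (D : DoubleCx.{u})

/-- The differential of the total complex. -/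
def d : (∀ p q, D.M p q) →+ (∀ p q, D.M p q) where
  toFun x p q := D.v p q (x (p + 1) q) + D.h p q (x p (q + 1))
  map_zero' := by ext; simp
  map_add' x y := by ext; simp; abel

theorem d_apply (x : ∀ p q, D.M p q) (p q : ℕ) :
    D.d x p q = D.v p q (x (p + 1) q) + D.h p q (x p (q + 1)) := rfl

/-- The total complex, filtered by the second degree. -/
abbrev fd : FiltDiff.{u} where
  K := ∀ p q, D.M p q
  d := D.d
  d_d x := by
    ext p q
    simp only [d_apply, map_add, D.v_v, D.h_h, Pi.zero_apply, zero_add, add_zero]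
    exact D.anti p q _
  A n q :=
    { carrier := {x | ∀ i j, x i j ≠ 0 → (i : ℤ) + j = n ∧ (j : ℤ) ≤ q}
      zero_mem' := fun i j h => (h rfl).elim
      add_mem' := fun {x y} hx hy i j h => by
        by_cases h0 : x i j = 0
        · exact hy i j fun h1 => h (by rw [Pi.add_apply, Pi.add_apply, h0, h1, add_zero])
        · exact hx i j h0
      neg_mem' := fun {x} hx i j h => hx i j fun h0 => h (by
        rw [Pi.neg_apply, Pi.neg_apply, h0, neg_zero]) }
  mono n q q' h x hx i j h0 := ⟨(hx i j h0).1, (hx i j h0).2.trans h⟩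
  d_mem {n q x} hx i j h0 := by
    by_cases h1 : x (i + 1) j = 0
    · have h2 : x i (j + 1) ≠ 0 := fun h2 => h0 (by rw [d_apply, h1, h2, map_zero, map_zero, add_zero])
      have := hx _ _ h2
      push_cast at this
      lia
    · have := hx _ _ h1
      push_cast at this
      lia
  bot {n q} hq x hx := by
    ext i j
    by_contra h0
    have := hx i j h0
    lia
  top n q x hx i j h0 := by
    have := hx i j h0
    lia

variable {D}

theorem eq_zero_of_mem_A {n q : ℤ} {x : ∀ p q, D.M p q} (hx : x ∈ D.fd.A n q) {i j : ℕ}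
    (h : (i : ℤ) + j ≠ n ∨ q < j) : x i j = 0 := by
  by_contra h0
  have := hx i j h0
  lia

theorem mem_A_of_le {n q q' : ℤ} {x : ∀ p q, D.M p q} (hx : x ∈ D.fd.A n q)
    (h : ∀ i j : ℕ, (i : ℤ) + j = n → q' < j → j ≤ q → x i j = 0) : x ∈ D.fd.A n q' := by
  intro i j h0
  have := hx i j h0
  refine ⟨this.1, ?_⟩
  by_contra h1
  exact h0 (h i j this.1 (by lia) this.2)

variable (D) in
/-- The element with a single component. -/
def single (p q : ℕ) (m : D.M p q) : ∀ i j, D.M i j := Pi.single p (Pi.single q m)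

theorem single_self (p q : ℕ) (m : D.M p q) : D.single p q m p q = m := by
  simp [single]

theorem single_ne {p q i j : ℕ} (m : D.M p q) (h : i ≠ p ∨ j ≠ q) : D.single p q m i j = 0 := by
  by_cases hi : i = p
  · subst hi
    rw [single, Pi.single_eq_same, Pi.single_eq_of_ne (h.resolve_left (· rfl))]
  · rw [single, Pi.single_eq_of_ne hi]
    rfl

theorem single_mem {p q : ℕ} (m : D.M p q) {n q' : ℤ} (hn : (p : ℤ) + q = n) (hq : (q : ℤ) ≤ q') :
    D.single p q m ∈ D.fd.A n q' := by
  intro i j h0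
  have : i = p ∧ j = q := by
    by_contra h
    exact h0 (single_ne m (by lia))
  lia

variable (D) in
/-- The double complex with the two directions exchanged. -/
def swap : DoubleCx.{u} where
  M p q := D.M q p
  v p q := D.h q p
  h p q := D.v q p
  v_v p q := D.h_h q p
  h_h p q := D.v_v q p
  anti p q x := by rw [add_comm]; exact D.anti q p x

/-- The homology uses only the subgroups `A n n`, where the condition `j ≤ n` follows from `i + j =
n`; so it does not see which direction defines the filtration. -/
theorem swap_H (n : ℤ) : Nonempty (D.swap.fd.H n ≃+ D.fd.H n) := by
  let σ : (∀ p q, D.swap.M p q) ≃+ (∀ p q, D.M p q) :=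
    { toFun := fun x p q => x q p
      invFun := fun x p q => x q p
      left_inv := fun _ => rfl
      right_inv := fun _ => rfl
      map_add' := fun _ _ => rfl }
  have hd (x) : D.d (σ x) = σ (D.swap.d x) := by
    ext p q
    exact add_comm _ _
  have hA (n x) : σ x ∈ D.fd.A n n ↔ x ∈ D.swap.fd.A n n := by
    constructor <;> intro hx i j h0 <;> have := hx j i h0 <;> lia
  have hc : (D.swap.fd.cyc n).map σ.toAddMonoidHom = D.fd.cyc n := by
    ext x
    constructor
    · rintro ⟨y, hy, rfl⟩
      refine ⟨(hA _ _).2 hy.1, (hd y).trans ?_⟩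
      have := hy.2
      exact congrArg σ this
    · intro hx
      refine ⟨σ.symm x, ⟨(hA _ _).1 hx.1, σ.injective ((hd _).symm.trans ?_)⟩, rfl⟩
      exact hx.2
  have hb (x) : σ x ∈ D.fd.bdry n ↔ x ∈ D.swap.fd.bdry n := by
    constructor
    · rintro ⟨y, hy, e⟩
      exact ⟨σ.symm y, (hA _ _).1 hy, σ.injective ((hd _).symm.trans e)⟩
    · rintro ⟨y, hy, e⟩
      exact ⟨σ y, (hA _ _).2 hy, (hd _).trans (congrArg σ e)⟩
  let τ : D.swap.fd.cyc n ≃+ D.fd.cyc n :=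
    (σ.addSubgroupMap (D.swap.fd.cyc n)).trans (AddEquiv.addSubgroupCongr hc)
  have hτ (x) : (τ x).1 = σ x.1 := rfl
  refine ⟨QuotientAddGroup.congr _ _ τ ?_⟩
  ext x
  constructor
  · rintro ⟨y, hy, rfl⟩
    exact (hb _).2 hy
  · intro hx
    refine ⟨τ.symm x, (hb _).1 ?_, τ.apply_symm_apply x⟩
    have : σ (τ.symm x).1 = x.1 := congrArg Subtype.val (τ.apply_symm_apply x)
    exact (congrArg (· ∈ D.fd.bdry n) this).mpr hx

/-! ### Total homology of a double complex that is exact in one direction -/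

section Augmentation

variable {N : ℕ → Type*} [∀ q, AddCommGroup (N q)] (ε : ∀ q, D.M 0 q →+ N q)
  (hεv : ∀ q x, ε q x = 0 ↔ ∃ y, D.v 0 q y = x)
  (hv : ∀ p q x, D.v p q x = 0 → ∃ y, D.v (p + 1) q y = x)

-- The component of `x` of top filtration is a `v`-cycle, or is killed by `ε` if it lies in column
-- `0`; hence it equals `v m` for some `m`. Subtracting the total boundary of `m` lowers the
-- filtration, and `ε ∘ v = 0` keeps the hypothesis on column `0` intact. With the bound written as
-- `k - 1`, the induction starts in filtration `-1`, where everything vanishes.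
include hεv hv in
theorem exists_d_eq (n : ℤ) (k : ℕ) (x : ∀ p q, D.M p q) (hx : x ∈ D.fd.A n ((k : ℤ) - 1))
    (hdx : D.d x = 0) (hε : ∀ j : ℕ, (j : ℤ) = n → ε j (x 0 j) = 0) :
    ∃ y ∈ D.fd.A (n + 1) ((k : ℤ) - 1), D.d y = x := by
  induction k generalizing x with
  | zero =>
    have : x = 0 := D.fd.bot (by simp) hx
    exact ⟨0, zero_mem _, by rw [map_zero, this]⟩
  | succ k ih =>
    have hk : ((k + 1 : ℕ) : ℤ) - 1 = k := by lia
    rw [hk] at hx ⊢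
    suffices ∃ y ∈ D.fd.A (n + 1) k, x - D.d y ∈ D.fd.A n ((k : ℤ) - 1) ∧
        ∀ j, ε j (D.d y 0 j) = 0 by
      obtain ⟨y, hy, hxy, hyε⟩ := this
      obtain ⟨z, hz, e⟩ := ih (x - D.d y) hxy
        (by rw [map_sub, hdx]; exact (zero_sub _).trans (neg_eq_zero.2 (D.fd.d_d y)))
        (fun j hj => by
          change ε j (x 0 j - D.d y 0 j) = 0
          rw [map_sub, hε j hj, hyε, sub_zero])
      refine ⟨y + z, add_mem hy (D.fd.mono _ (by lia) hz), ?_⟩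
      rw [map_add, e, add_sub_cancel]
    -- The component to be removed sits at `(n - k, k)`, which is outside the quadrant when `n < k`.
    by_cases hn : n < k
    · refine ⟨0, zero_mem _, ?_, fun j => by rw [map_zero]; exact map_zero _⟩
      rw [map_zero, sub_zero]
      exact mem_A_of_le hx fun i j h1 h2 h3 => by lia
    · obtain ⟨i, rfl⟩ : ∃ i : ℕ, n = i + k := ⟨(n - k).toNat, by lia⟩
      obtain ⟨m, hm⟩ : ∃ m, D.v i k m = x i k := by
        cases i with
        | zero => exact (hεv k _).1 (hε k (by simp))
        | succ i =>
          refine hv i k _ ?_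
          have e := congrFun (congrFun hdx i) k
          rwa [d_apply, eq_zero_of_mem_A hx (i := i) (j := k + 1) (by lia), map_zero,
            add_zero] at e
      have hy : D.single (i + 1) k m ∈ D.fd.A ((i : ℤ) + k + 1) k :=
        single_mem m (by push_cast; ring) le_rfl
      refine ⟨_, hy, mem_A_of_le (q := k) (sub_mem hx ?_) fun i' j h1 h2 h3 => ?_, fun j => ?_⟩
      · have := D.fd.d_mem hy
        rwa [add_sub_cancel_right] at this
      · obtain rfl : j = k := by lia
        obtain rfl : i' = i := by lia
        change x i' j - D.d _ i' j = 0
        rw [d_apply, single_self, single_ne m (by lia), map_zero, add_zero, hm, sub_self]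
      · rw [d_apply, single_ne m (i := 0) (by lia), map_zero, add_zero]
        exact (hεv j _).2 ⟨_, rfl⟩

end Augmentation

/-- If every `M_{•,q}` is a resolution of `N_q`, then the total complex has the homology of `N`. -/
theorem total_homology_equiv (N : ChainComplex AddCommGrpCat.{u} ℕ) (ε : ∀ q, D.M 0 q →+ N.X q)
    (hε : ∀ q, Function.Surjective (ε q)) (hεv : ∀ q x, ε q x = 0 ↔ ∃ y, D.v 0 q y = x)
    (hv : ∀ p q x, D.v p q x = 0 → ∃ y, D.v (p + 1) q y = x)
    (hεh : ∀ q x, ε q (D.h 0 q x) = (N.d (q + 1) q).hom (ε (q + 1) x)) (n : ℕ) :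
    Nonempty (N.homology n ≃+ D.fd.H n) := by
  have key (n : ℤ) (x : ∀ p q, D.M p q) (hx : x ∈ D.fd.A n n) (hdx : D.d x = 0)
      (h0 : ∀ j : ℕ, (j : ℤ) = n → ε j (x 0 j) = 0) : ∃ y ∈ D.fd.A (n + 1) n, D.d y = x := by
    obtain ⟨y, hy, e⟩ := exists_d_eq ε hεv hv n (n + 1).toNat x
      (mem_A_of_le hx fun i j h1 h2 h3 => by lia) hdx h0
    refine ⟨y, mem_A_of_le hy fun i j h1 h2 h3 => by lia, e⟩
  have hεd (x : ∀ p q, D.M p q) (q) : ε q (D.d x 0 q) = (N.d (q + 1) q).hom (ε (q + 1) (x 0 (q + 1))) := by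
    rw [d_apply, map_add, (hεv q _).2 ⟨_, rfl⟩, zero_add, hεh]
  let φ : D.fd.cyc n →+ N.X n :=
    { toFun := fun x => ε n (x.1 0 n)
      map_zero' := map_zero _
      map_add' := fun _ _ => map_add _ _ _ }
  refine homologicalComplex_homology_equiv N n _ φ ?_ ?_ ?_ ?_ ?_
  · rintro ⟨z, hz⟩ j hj
    obtain rfl : j + 1 = n := hj
    refine (hεd z j).symm.trans ?_
    have : D.d z = 0 := hz.2
    rw [this]
    exact map_zero _
  · intro x hx
    obtain ⟨m, rfl⟩ := hε n x
    have hm : D.single 0 n m ∈ D.fd.A n n := single_mem m (by simp) le_rfl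
    -- Placing `m` at `(0, n)` gives an element whose boundary is killed by `ε`, so this boundary is
    -- `d y` with `y` of filtration `n - 1`. Subtracting `y` produces a total cycle and leaves the
    -- component at `(0, n)` unchanged.
    obtain ⟨y, hy, e⟩ := key (n - 1) (D.d (D.single 0 n m)) (D.fd.top _ _ (D.fd.d_mem hm))
      (D.fd.d_d _) (fun j hj => by
        obtain rfl : j + 1 = n := by lia
        rw [hεd, single_self]
        exact hx j rfl)
    rw [sub_add_cancel] at hy
    refine ⟨⟨D.single 0 n m - y, FiltDiff.mem_cyc.2
      ⟨sub_mem hm (D.fd.mono _ (by lia) hy), ?_⟩⟩, n, 0, ?_⟩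
    · refine (map_sub D.d _ _).trans ?_
      rw [e, sub_self]
    · rw [map_zero, add_zero]
      change _ = ε n (D.single 0 n m 0 n - y 0 n)
      rw [single_self, eq_zero_of_mem_A hy (by lia), sub_zero]
  · rintro ⟨_, hz⟩ ⟨w, hw, rfl⟩
    exact ⟨n + 1, ε (n + 1) (w 0 (n + 1)), (hεd w n).symm⟩
  · rintro ⟨z, hz⟩ k y hr e
    obtain rfl : n + 1 = k := hr
    obtain ⟨m, rfl⟩ := hε _ y
    have hm : D.single 0 (n + 1) m ∈ D.fd.A (n + 1) (n + 1) :=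
      single_mem m (by simp) (by simp)
    -- After subtracting the boundary of a lift of `y`, the cycle `z` has a component at `(0, n)`
    -- killed by `ε`, so the rest bounds as well.
    obtain ⟨w, hw, e'⟩ := key n (z - D.d (D.single 0 (n + 1) m)) (sub_mem hz.1 (by
        have := D.fd.top _ _ (D.fd.d_mem hm)
        rwa [add_sub_cancel_right] at this)) (by
          rw [map_sub]
          have h1 : D.d z = 0 := hz.2
          have h2 : D.d (D.d (D.single 0 (n + 1) m)) = 0 := D.fd.d_d _
          rw [h1, h2, sub_zero])
        (fun j hj => by
          obtain rfl : j = n := by lia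
          change ε j (z 0 j - D.d _ 0 j) = 0
          rw [map_sub, hεd, single_self, e]
          exact sub_self _)
    refine ⟨D.single 0 (n + 1) m + w, add_mem hm (D.fd.mono _ (by lia) hw), ?_⟩
    refine (map_add D.d _ _).trans ?_
    rw [e', add_sub_cancel]
    rfl
  · rintro ⟨z, hz⟩ e
    obtain ⟨w, hw, e'⟩ := key n z hz.1 hz.2 (fun j hj => by
      obtain rfl : j = n := by lia
      exact e)
    exact ⟨w, D.fd.mono _ (by lia) hw, e'⟩

/-! ### The second page of a double complex -/

variable (D) in
/-- The cycles of the first differential. -/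
def vcyc : ∀ p q, AddSubgroup (D.M p q)
  | 0, _ => ⊤
  | p + 1, q => (D.v p q).ker

theorem mem_vcyc {p q : ℕ} {m : D.M p q} (x : ∀ i j, D.M i j) (hx : x p q = m)
    (h0 : ∀ i, i + 1 = p → x i (q + 1) = 0) (hd : ∀ i, i + 1 = p → D.d x i q = 0) :
    m ∈ D.vcyc p q := by
  subst hx
  cases p with
  | zero => trivial
  | succ p =>
    have := hd p rfl
    rwa [d_apply, h0 p rfl, map_zero, add_zero] at this

theorem v_of_mem_vcyc {p q : ℕ} {m : D.M (p + 1) q} (hm : m ∈ D.vcyc (p + 1) q) : D.v p q m = 0 :=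
  hm

theorem h_mem_vcyc {p q : ℕ} {m : D.M p (q + 1)} (hm : m ∈ D.vcyc p (q + 1)) :
    D.h p q m ∈ D.vcyc p q := by
  cases p with
  | zero => trivial
  | succ p =>
    have := D.anti p q m
    rw [v_of_mem_vcyc hm, map_zero, add_zero] at this
    exact this

theorem apply_mem_vcyc {p q : ℕ} {x : ∀ i j, D.M i j} {r : ℤ} (hr : 1 ≤ r)
    (hx : x ∈ D.fd.Z r ((p : ℤ) + q) q) : x p q ∈ D.vcyc p q :=
  mem_vcyc x rfl (fun i _ => eq_zero_of_mem_A hx.1 (by lia))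
    fun i _ => eq_zero_of_mem_A (FiltDiff.mem_Z.1 hx).2 (by lia)

theorem d_sub_apply (x y : ∀ i j, D.M i j) (p q : ℕ) :
    D.d (x - y) p q = D.d x p q - D.d y p q := by
  rw [map_sub]
  rfl

/-- Membership in the denominator of the second page is decided by the leading component. The
element with components `m` and `w` has boundary of filtration `q` because `v m = 0`, and this
boundary agrees with `z` at `(p, q)`; the difference has filtration `q - 1`. -/
theorem mem_Bd_of_apply_eq {p q : ℕ} {z : ∀ i j, D.M i j} (hz : z ∈ D.fd.Z 2 ((p : ℤ) + q) q)
    (w : D.M (p + 1) q) {m : D.M p (q + 1)} (hm : m ∈ D.vcyc p (q + 1))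
    (e : D.v p q w + D.h p q m = z p q) : z ∈ D.fd.Bd 2 ((p : ℤ) + q) q := by
  let y : ∀ i j, D.M i j := D.single p (q + 1) m + D.single (p + 1) q w
  have hy : y ∈ D.fd.A ((p : ℤ) + q + 1) (q + 1) :=
    add_mem (single_mem m (by push_cast; ring) (by simp))
      (single_mem w (by push_cast; ring) (by lia))
  have hyd : D.d y ∈ D.fd.A ((p : ℤ) + q) q := by
    have h1 := D.fd.d_mem hy
    rw [add_sub_cancel_right] at h1
    refine mem_A_of_le h1 fun i j h1 h2 h3 => ?_
    obtain rfl : j = q + 1 := by lia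
    obtain rfl : i + 1 = p := by lia
    rw [d_apply, eq_zero_of_mem_A hy (i := i) (by lia), map_zero, add_zero]
    have : y (i + 1) (q + 1) = m := by
      change D.single (i + 1) (q + 1) m _ _ + D.single (i + 1 + 1) q w _ _ = m
      rw [single_self, single_ne w (by lia), add_zero]
    rw [this]
    exact v_of_mem_vcyc hm
  have hyz : D.d y p q = z p q := by
    have e1 : y (p + 1) q = w := by
      change D.single p (q + 1) m _ _ + D.single (p + 1) q w _ _ = w
      rw [single_self, single_ne m (by lia), zero_add]
    have e2 : y p (q + 1) = m := by
      change D.single p (q + 1) m _ _ + D.single (p + 1) q w _ _ = m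
      rw [single_self, single_ne w (by lia), add_zero]
    rw [d_apply, e1, e2, e]
  refine FiltDiff.mem_Bd.2 ⟨z - D.d y, FiltDiff.mem_Z.2 ⟨?_, ?_⟩, y, FiltDiff.mem_Z.2 ⟨?_, ?_⟩, ?_⟩
  · refine mem_A_of_le (sub_mem hz.1 hyd) fun i j h1 h2 h3 => ?_
    obtain rfl : j = q := by lia
    obtain rfl : i = p := by lia
    change z i j - D.d y i j = 0
    rw [hyz, sub_self]
  · have h1 : D.fd.d (z - D.d y) = D.fd.d z :=
      (map_sub D.fd.d _ _).trans (by rw [show D.fd.d (D.d y) = 0 from D.fd.d_d y, sub_zero])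
    rw [h1]
    exact D.fd.mono _ (by lia) (FiltDiff.mem_Z.1 hz).2
  · exact D.fd.mono _ (by lia) hy
  · rw [add_sub_cancel_right]
    exact D.fd.mono _ (by lia) hyd
  · exact sub_add_cancel _ _

theorem d_single_apply {p q : ℕ} {m : D.M p q} (hm : m ∈ D.vcyc p q) (i : ℕ) (hi : i + 1 = p) :
    D.d (D.single p q m) i q = 0 := by
  subst hi
  rw [d_apply, single_self, single_ne m (by lia), map_zero, add_zero]
  exact v_of_mem_vcyc hm

theorem single_mem_Z {p : ℕ} {m : D.M p 0} (hm : m ∈ D.vcyc p 0) :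
    D.single p 0 m ∈ D.fd.Z 2 ((p : ℤ) + (0 : ℕ)) (0 : ℕ) := by
  have hm' : D.single p 0 m ∈ D.fd.A ((p : ℤ) + (0 : ℕ)) (0 : ℕ) := single_mem m rfl le_rfl
  refine FiltDiff.mem_Z.2 ⟨hm', mem_A_of_le (D.fd.d_mem hm') fun i j h1 h2 h3 => ?_⟩
  obtain rfl : j = 0 := by lia
  exact d_single_apply hm i (by lia)

/-- The correction `w` cancels `h m` at `(p, q)`, and `v m` vanishes. The only boundary component
left comes from `h w`, two filtration steps below `q + 1`. -/
theorem single_sub_single_mem_Z {p q : ℕ} {m : D.M p (q + 1)} (hm : m ∈ D.vcyc p (q + 1))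
    {w : D.M (p + 1) q} (hw : D.v p q w = D.h p q m) :
    D.single p (q + 1) m - D.single (p + 1) q w ∈
      D.fd.Z 2 ((p : ℤ) + (q + 1 : ℕ)) (q + 1 : ℕ) := by
  have hm' : D.single p (q + 1) m ∈ D.fd.A ((p : ℤ) + (q + 1 : ℕ)) (q + 1 : ℕ) :=
    single_mem m rfl le_rfl
  have hw' : D.single (p + 1) q w ∈ D.fd.A ((p : ℤ) + (q + 1 : ℕ)) (q + 1 : ℕ) :=
    single_mem w (by push_cast; ring) (by lia)
  have hx : D.single p (q + 1) m - D.single (p + 1) q w ∈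
    D.fd.A ((p : ℤ) + (q + 1 : ℕ)) (q + 1 : ℕ) := sub_mem hm' hw'
  refine FiltDiff.mem_Z.2 ⟨hx, mem_A_of_le (D.fd.d_mem hx) fun i j h1 h2 h3 => ?_⟩
  refine (d_sub_apply _ _ i j).trans ?_
  by_cases hj : j = q + 1
  · subst hj
    rw [d_single_apply hm i (by lia), d_apply, single_ne w (by lia), single_ne w (by lia),
      map_zero, map_zero, add_zero, sub_zero]
  · obtain rfl : j = q := by lia
    obtain rfl : i = p := by lia
    rw [d_apply, d_apply, single_self, single_self, single_ne w (by lia),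
      single_ne m (by lia), map_zero, map_zero, add_zero, zero_add, hw, sub_self]

/-- The second page of the spectral sequence of a double complex. -/
theorem secondPage_equiv (p : ℕ) (L : ChainComplex AddCommGrpCat.{u} ℕ)
    (π : ∀ q, D.vcyc p q →+ L.X q) (hπ : ∀ q, Function.Surjective (π q))
    (hk : ∀ q x, π q x = 0 ↔ ∃ y, D.v p q y = x.1) (s : ℤ) (hs : s * s = 1)
    (hπh : ∀ q (x : D.vcyc p (q + 1)), π q ⟨D.h p q x.1, h_mem_vcyc x.2⟩ =
      s • (L.d (q + 1) q).hom (π (q + 1) x)) (q : ℕ) :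
    Nonempty (L.homology q ≃+ D.fd.E 2 ((p : ℤ) + q) q) := by
  -- Only the leading component of an element of `Z 2` matters; it is a `v`-cycle, and `π` takes its
  -- class.
  let φ : D.fd.Z 2 ((p : ℤ) + q) q →+ L.X q :=
    { toFun := fun x => π q ⟨x.1 p q, apply_mem_vcyc (by lia) x.2⟩
      map_zero' := map_zero (π q)
      map_add' := fun x y => map_add (π q) ⟨x.1 p q, apply_mem_vcyc (by lia) x.2⟩
        ⟨y.1 p q, apply_mem_vcyc (by lia) y.2⟩ }
  -- As `s` is its own inverse, the sign between `h` and the differential of `L` can be moved to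
  -- either side.
  have hLd (q) (x : D.vcyc p (q + 1)) : (L.d (q + 1) q).hom (π (q + 1) x) =
      s • π q ⟨D.h p q x.1, h_mem_vcyc x.2⟩ := by
    rw [hπh, smul_smul, hs, one_smul]
  have hsub {q} {a b : D.M p q} (ha : a ∈ D.vcyc p q) (hb : b ∈ D.vcyc p q)
      (h : ∃ y, D.v p q y = a - b) : π q ⟨a, ha⟩ = π q ⟨b, hb⟩ := by
    rw [← sub_eq_zero, ← map_sub]
    exact (hk q _).2 h
  have hbd (z : D.fd.Z 2 ((p : ℤ) + q) q) (w : D.M (p + 1) q) (m : D.M p (q + 1))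
      (hm : m ∈ D.vcyc p (q + 1)) (e : D.v p q w + D.h p q m = z.1 p q) :
      z ∈ (D.fd.Bd 2 ((p : ℤ) + q) q).addSubgroupOf (D.fd.Z 2 ((p : ℤ) + q) q) :=
    mem_Bd_of_apply_eq z.2 w hm e
  refine homologicalComplex_homology_equiv L q _ φ ?_ ?_ ?_ ?_ ?_
  · rintro ⟨z, hz⟩ j hj
    obtain rfl : j + 1 = q := hj
    refine (hLd j ⟨z p (j + 1), apply_mem_vcyc (by lia) hz⟩).trans ?_
    have e : D.d z p j = 0 := eq_zero_of_mem_A (FiltDiff.mem_Z.1 hz).2 (by push_cast; lia)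
    rw [d_apply, add_comm] at e
    rw [(hk _ _).2 ⟨-z (p + 1) j, by rw [map_neg]; exact (eq_neg_of_add_eq_zero_left e).symm⟩,
      smul_zero]
  · intro c hc
    obtain ⟨⟨m, hm⟩, rfl⟩ := hπ q c
    obtain ⟨x, hx, hxm⟩ : ∃ x ∈ D.fd.Z 2 ((p : ℤ) + q) q, x p q = m := by
      cases q with
      | zero =>
        exact ⟨_, single_mem_Z hm, single_self _ _ _⟩
      | succ q =>
        have h0 := hc q rfl
        rw [hLd] at h0
        have h0' : π q ⟨D.h p q m, h_mem_vcyc hm⟩ = 0 := by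
          have := congrArg (s • ·) h0
          dsimp only at this
          rwa [smul_smul, hs, one_smul, smul_zero] at this
        obtain ⟨w, hw⟩ := (hk _ _).1 h0'
        refine ⟨_, single_sub_single_mem_Z hm hw, ?_⟩
        · change D.single p (q + 1) m _ _ - D.single (p + 1) q w _ _ = m
          rw [single_self, single_ne w (by lia), sub_zero]
    refine ⟨⟨x, hx⟩, q, 0, ?_⟩
    rw [map_zero, add_zero]
    subst hxm
    rfl
  · rintro z hz
    obtain ⟨y, hy, w, hw, e⟩ := FiltDiff.mem_Bd.1 hz
    have hwd : D.d w ∈ D.fd.A ((p : ℤ) + q) q := by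
      have := (FiltDiff.mem_Z.1 hw).2
      rw [add_sub_cancel_right] at this
      exact D.fd.mono _ (by lia) this
    have hw1 : w ∈ D.fd.A ((p : ℤ) + q + 1) (q + 1) := D.fd.mono _ (by lia) hw.1
    have hwc : w p (q + 1) ∈ D.vcyc p (q + 1) := mem_vcyc w rfl
      (fun i _ => eq_zero_of_mem_A hw1 (by lia)) (fun i _ => eq_zero_of_mem_A hwd (by lia))
    refine ⟨q + 1, s • π (q + 1) ⟨_, hwc⟩, ?_⟩
    rw [map_zsmul, hLd, smul_smul, hs, one_smul]
    refine (hsub (apply_mem_vcyc (by lia) z.2) (h_mem_vcyc hwc) ⟨w (p + 1) q, ?_⟩).symm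
    -- The summand `y` has filtration `q - 1`, so it does not contribute at `(p, q)`. Modulo the
    -- image of `v`, the leading component of `z` is thus `h` of a `v`-cycle.
    have e' : y p q + (D.v p q (w (p + 1) q) + D.h p q (w p (q + 1))) = z.1 p q :=
      congrFun (congrFun e p) q
    rw [← e', eq_zero_of_mem_A hy.1 (by lia), zero_add, add_sub_cancel_right]
  · rintro z k y hr e
    obtain rfl : q + 1 = k := hr
    obtain ⟨m, rfl⟩ := hπ _ y
    rw [hLd, ← map_zsmul] at e
    have h0 : π q (⟨z.1 p q, apply_mem_vcyc (by lia) z.2⟩ - s • ⟨D.h p q m.1, h_mem_vcyc m.2⟩) = 0 := by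
      rw [map_sub, sub_eq_zero]
      exact e.symm
    obtain ⟨w, hw⟩ := (hk _ _).1 h0
    refine hbd z w (s • m.1) (zsmul_mem m.2 s) ?_
    rw [hw, map_zsmul]
    exact sub_add_cancel _ _
  · intro z e
    obtain ⟨w, hw⟩ := (hk _ _).1 e
    exact hbd z w 0 (zero_mem _) (by rw [hw, map_zero, add_zero])

end DoubleCx

/-! ### Criteria for exactness -/

section Exactness

/-- Evaluation commutes with homology, and a functor is zero as soon as all its values are. -/
theorem functor_exact_iff {J : Type*} [Category* J] {A : Type*} [Category* A] [Abelian A]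
    (S : ShortComplex (J ⥤ A)) :
    S.Exact ↔ ∀ j, (S.map ((evaluation J A).obj j)).Exact := by
  refine ⟨fun h j => h.map _, fun h => ?_⟩
  rw [ShortComplex.exact_iff_isZero_homology, Functor.isZero_iff]
  intro j
  exact ((ShortComplex.exact_iff_isZero_homology _).1 (h j)).of_iso
    (S.mapHomologyIso ((evaluation J A).obj j)).symm

/-- Embed the cokernel of `S.f` into an injective. The resulting map factors through `S.g`, so the
kernel of `S.g` maps to zero in the cokernel. The criterion suits tensor products, whose maps into
an injective are known by adjunction. -/
theorem exact_of_injective_test {A : Type*} [Category* A] [Abelian A] [EnoughInjectives A]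
    (S : ShortComplex A) (h : ∀ (I : A) [Injective I] (f : S.X₂ ⟶ I), S.f ≫ f = 0 →
      ∃ g : S.X₃ ⟶ I, S.g ≫ g = f) : S.Exact := by
  rw [ShortComplex.exact_iff_kernel_ι_comp_cokernel_π_zero,
    ← cancel_mono (Injective.ι (cokernel S.f))]
  obtain ⟨g, hg⟩ := h _ (cokernel.π S.f ≫ Injective.ι _) (by simp)
  rw [Category.assoc, ← hg, kernel.condition_assoc, zero_comp, zero_comp]

end Exactness

/-! ### Hom-tensor adjunctions and flatness of projectives -/

section InternalHom

theorem addCommGrp_hom_ext {A B : AddCommGrpCat.{u}} {f g : A ⟶ B}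
    (h : ∀ a : A, f.hom a = g.hom a) : f = g :=
  AddCommGrpCat.hom_ext (AddMonoidHom.ext h)

/-- Homomorphisms `A ⊗ B ⟶ C` as homomorphisms `A ⟶ Hom(B, C)`. -/
noncomputable def tensHomEquiv (A B C : AddCommGrpCat.{u}) :
    (tens A B ⟶ C) ≃ (A ⟶ AddCommGrpCat.of (B ⟶ C)) where
  toFun f := AddCommGrpCat.ofHom
    { toFun := fun a => AddCommGrpCat.ofHom
        { toFun := fun b => f.hom (a ⊗ₜ[ℤ] b)
          map_zero' := by rw [TensorProduct.tmul_zero]; exact map_zero f.hom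
          map_add' := fun b b' => by rw [TensorProduct.tmul_add]; exact map_add f.hom _ _ }
      map_zero' := by
        ext b
        change f.hom ((0 : A) ⊗ₜ[ℤ] b) = 0
        rw [TensorProduct.zero_tmul]
        exact map_zero f.hom
      map_add' := fun a a' => by
        ext b
        change f.hom ((a + a') ⊗ₜ[ℤ] b) = f.hom (a ⊗ₜ[ℤ] b) + f.hom (a' ⊗ₜ[ℤ] b)
        rw [TensorProduct.add_tmul]
        exact map_add f.hom _ _ }
  invFun g := AddCommGrpCat.ofHom (TensorProduct.lift (AddMonoidHom.toIntLinearMap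
    { toFun := fun a => (g.hom a).hom.toIntLinearMap
      map_zero' := by rw [map_zero]; rfl
      map_add' := fun a a' => by rw [map_add]; rfl })).toAddMonoidHom
  left_inv f := tens_hom_ext fun _ _ => rfl
  right_inv g := by
    ext a b
    rfl

/-- The contravariant functor `Hom(-, C)`. -/
def homInto (C : AddCommGrpCat.{u}) : AddCommGrpCat.{u}ᵒᵖ ⥤ AddCommGrpCat.{u} where
  obj B := AddCommGrpCat.of (B.unop ⟶ C)
  map f := AddCommGrpCat.ofHom
    { toFun := fun g => f.unop ≫ g
      map_zero' := comp_zero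
      map_add' := fun _ _ => Preadditive.comp_add _ _ _ _ _ _ }
  map_id X := addCommGrp_hom_ext fun g => Category.id_comp (g : X.unop ⟶ C)
  map_comp {X _ _} f f' := addCommGrp_hom_ext fun g =>
    Category.assoc f'.unop f.unop (g : X.unop ⟶ C)

/-- The natural transformation `Hom(-, C) ⟶ Hom(-, C')`. -/
def homIntoMap {C C' : AddCommGrpCat.{u}} (k : C ⟶ C') : homInto C ⟶ homInto C' where
  app _ := AddCommGrpCat.ofHom
    { toFun := fun g => g ≫ k
      map_zero' := zero_comp
      map_add' := fun _ _ => Preadditive.add_comp _ _ _ _ _ _ }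
  naturality _ _ f := addCommGrp_hom_ext fun g =>
    Category.assoc f.unop g k

theorem homInto_exact (I : AddCommGrpCat.{u}) [Injective I] (S : ShortComplex AddCommGrpCat.{u})
    (hS : S.Exact) (w : (homInto I).map S.g.op ≫ (homInto I).map S.f.op = 0) :
    (ShortComplex.mk _ _ w).Exact := by
  rw [ShortComplex.ab_exact_iff]
  intro (f : S.X₂ ⟶ I) (hf : S.f ≫ f = 0)
  exact ⟨hS.descToInjective f hf, hS.comp_descToInjective f hf⟩

variable {P : Type u} [PartialOrder P]

/-- The presheaf `p ↦ Hom(G(p), A)`, as a functor of `A`. -/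
def homPSh (G : CoPSh P) : AddCommGrpCat.{u} ⥤ PSh P where
  obj A := G.op ⋙ homInto A
  map k := Functor.whiskerLeft G.op (homIntoMap k)
  map_id A := by
    ext p : 2
    exact addCommGrp_hom_ext fun g => Category.comp_id (g : G.obj p.unop ⟶ A)
  map_comp {A _ _} k k' := by
    ext p : 2
    exact addCommGrp_hom_ext fun g => (Category.assoc (g : G.obj p.unop ⟶ A) k k').symm

/-- The map of presheaves induced by a map of copresheaves. -/
def homPShMap {G G' : CoPSh P} (k : G ⟶ G') (A : AddCommGrpCat.{u}) :
    (homPSh G').obj A ⟶ (homPSh G).obj A :=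
  Functor.whiskerRight (NatTrans.op k) (homInto A)

/-- The copresheaf `p ↦ Hom(F(p), A)`. -/
def homCoPSh (F : PSh P) (A : AddCommGrpCat.{u}) : CoPSh P := F.rightOp ⋙ homInto A

/-- The map of copresheaves induced by a map of presheaves. -/
def homCoPShMap {F F' : PSh P} (k : F ⟶ F') (A : AddCommGrpCat.{u}) :
    homCoPSh F' A ⟶ homCoPSh F A :=
  Functor.whiskerRight (NatTrans.rightOp k) (homInto A)

/-- Homomorphisms `F ⊗_P G ⟶ A` as morphisms `F ⟶ Hom(G, A)`. -/
noncomputable def tensorHomEquiv (F : PSh P) (G : CoPSh P) (A : AddCommGrpCat.{u}) :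
    (tensorObj F G ⟶ A) ≃ (F ⟶ (homPSh G).obj A) where
  toFun f :=
    { app := fun p => tensHomEquiv _ _ _ (tensorι F G p.unop ≫ f)
      naturality := fun x y h => by
        refine addCommGrp_hom_ext fun a => addCommGrp_hom_ext fun b => ?_
        have e := congrArg (fun k => (k ≫ f).hom (a ⊗ₜ[ℤ] b))
          (tensorι_condition F G (leOfHom h.unop))
        exact e }
  invFun k := tensorDesc (fun p => (tensHomEquiv _ _ _).symm (k.app (op p))) fun y x h =>
    tens_hom_ext fun a b => by
      have e := congrArg (fun t => (t.hom a).hom b) (k.naturality (homOfLE h).op)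
      exact e
  left_inv f := tensorObj_hom_ext fun p => by
    rw [tensorι_desc]
    exact Equiv.symm_apply_apply _ _
  right_inv k := by
    ext p : 2
    dsimp only
    rw [tensorι_desc]
    exact Equiv.apply_symm_apply _ _

/-- Homomorphisms `F ⊗_P G ⟶ A` as morphisms `G ⟶ Hom(F, A)`. -/
noncomputable def tensorHomEquiv' (F : PSh P) (G : CoPSh P) (A : AddCommGrpCat.{u}) :
    (tensorObj F G ⟶ A) ≃ (G ⟶ homCoPSh F A) where
  toFun f :=
    { app := fun p => AddCommGrpCat.ofHom
        { toFun := fun b => AddCommGrpCat.ofHom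
            { toFun := fun a => f.hom ((tensorι F G p).hom (a ⊗ₜ[ℤ] b))
              map_zero' := by
                rw [TensorProduct.zero_tmul]
                exact map_zero (tensorι F G p ≫ f).hom
              map_add' := fun a a' => by
                rw [TensorProduct.add_tmul]
                exact map_add (tensorι F G p ≫ f).hom _ _ }
          map_zero' := by
            ext a
            change (tensorι F G p ≫ f).hom (a ⊗ₜ[ℤ] (0 : G.obj p)) = 0
            rw [TensorProduct.tmul_zero]
            exact map_zero (tensorι F G p ≫ f).hom
          map_add' := fun b b' => by
            ext a
            change (tensorι F G p ≫ f).hom (a ⊗ₜ[ℤ] (b + b')) =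
              (tensorι F G p ≫ f).hom (a ⊗ₜ[ℤ] b) + (tensorι F G p ≫ f).hom (a ⊗ₜ[ℤ] b')
            rw [TensorProduct.tmul_add]
            exact map_add (tensorι F G p ≫ f).hom _ _ }
      naturality := fun x y h => by
        refine addCommGrp_hom_ext fun b => addCommGrp_hom_ext fun a => ?_
        have e := congrArg (fun k => (k ≫ f).hom (a ⊗ₜ[ℤ] b)) (tensorι_condition F G (leOfHom h))
        exact e.symm }
  invFun k := tensorDesc (fun p => (tensHomEquiv _ _ _).symm (AddCommGrpCat.ofHom
      { toFun := fun a => AddCommGrpCat.ofHom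
          { toFun := fun b => ((k.app p).hom b : F.obj (op p) ⟶ A).hom a
            map_zero' := by rw [map_zero]; rfl
            map_add' := fun b b' => by rw [map_add]; rfl }
        map_zero' := by
          ext b
          exact map_zero ((k.app p).hom b : F.obj (op p) ⟶ A).hom
        map_add' := fun a a' => by
          ext b
          exact map_add ((k.app p).hom b : F.obj (op p) ⟶ A).hom a a' })) fun y x h =>
    tens_hom_ext fun a b => by
      have e := congrArg (fun t => (t.hom b : F.obj (op x) ⟶ A).hom a) (k.naturality (homOfLE h))
      exact e.symm
  left_inv f := tensorObj_hom_ext fun p => by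
    rw [tensorι_desc]
    exact tens_hom_ext fun a b => rfl
  right_inv k := by
    ext p : 2
    refine addCommGrp_hom_ext fun b => addCommGrp_hom_ext fun a => ?_
    refine (congrArg (fun t => AddCommGrpCat.Hom.hom t (a ⊗ₜ[ℤ] b)) (tensorι_desc _ _ p)).trans ?_
    rfl

theorem tensorHomEquiv_hom {F F' : PSh P} (k : F ⟶ F') (G : CoPSh P) {A : AddCommGrpCat.{u}}
    (t : tensorObj F' G ⟶ A) :
    tensorHomEquiv F G A (tensorHom k G ≫ t) = k ≫ tensorHomEquiv F' G A t := by
  ext p : 2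
  refine addCommGrp_hom_ext fun a => addCommGrp_hom_ext fun b => ?_
  exact congrArg (fun s => AddCommGrpCat.Hom.hom s (a ⊗ₜ[ℤ] b)) (tensorι_hom_assoc k G p.unop t)

theorem tensorHomEquiv'_hom {F F' : PSh P} (k : F ⟶ F') (G : CoPSh P) {A : AddCommGrpCat.{u}}
    (t : tensorObj F' G ⟶ A) :
    tensorHomEquiv' F G A (tensorHom k G ≫ t) = tensorHomEquiv' F' G A t ≫ homCoPShMap k A := by
  ext p : 2
  refine addCommGrp_hom_ext fun b => addCommGrp_hom_ext fun a => ?_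
  exact congrArg (fun s => AddCommGrpCat.Hom.hom s (a ⊗ₜ[ℤ] b)) (tensorι_hom_assoc k G p t)

/-- The functor `- ⊗_P G` is left adjoint to `Hom(G, -)`. -/
noncomputable def tensorAdj (G : CoPSh P) : tensorWith G ⊣ homPSh G :=
  Adjunction.mkOfHomEquiv
    { homEquiv := fun F A => tensorHomEquiv F G A
      homEquiv_naturality_left_symm := fun {F' F A} f g => by
        refine (tensorHomEquiv F' G A).symm_apply_eq.2 ?_
        exact Eq.trans (congrArg (f ≫ ·) (Equiv.apply_symm_apply _ _).symm)
          (tensorHomEquiv_hom f G _).symm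
      homEquiv_naturality_right := fun f g => rfl }

/-- The map `F ⊗_P G ⟶ F ⊗_P G'` induced by a morphism of copresheaves. -/
noncomputable def tensorHomRight (F : PSh P) {G G' : CoPSh P} (k : G ⟶ G') :
    tensorObj F G ⟶ tensorObj F G' :=
  tensorDesc (fun p => tensMap (𝟙 (F.obj (op p))) (k.app p) ≫ tensorι F G' p) (by
    intro y x h
    have e := tensMap (𝟙 (F.obj (op x))) (k.app y) ≫= tensorι_condition F G' h
    rw [← Category.assoc, ← tensMap_comp, ← Category.assoc, ← tensMap_comp, Category.comp_id,
      Category.comp_id, Category.id_comp] at e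
    rw [← Category.assoc, ← tensMap_comp, ← Category.assoc, ← tensMap_comp, Category.comp_id,
      Category.comp_id, Category.id_comp, k.naturality, e])

theorem tensorι_homRight (F : PSh P) {G G' : CoPSh P} (k : G ⟶ G') (p : P) :
    tensorι F G p ≫ tensorHomRight F k = tensMap (𝟙 (F.obj (op p))) (k.app p) ≫ tensorι F G' p :=
  tensorι_desc _ _ p

theorem tensorι_homRight_assoc (F : PSh P) {G G' : CoPSh P} (k : G ⟶ G') (p : P)
    {A : AddCommGrpCat.{u}} (h : tensorObj F G' ⟶ A) :
    tensorι F G p ≫ tensorHomRight F k ≫ h =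
      tensMap (𝟙 (F.obj (op p))) (k.app p) ≫ tensorι F G' p ≫ h := by
  rw [← Category.assoc, tensorι_homRight, Category.assoc]

/-- The functor `F ⊗_P -`. -/
noncomputable def tensorLeftWith (F : PSh P) : CoPSh P ⥤ AddCommGrpCat.{u} where
  obj G := tensorObj F G
  map k := tensorHomRight F k
  map_id G := tensorObj_hom_ext fun p => by
    rw [tensorι_homRight, NatTrans.id_app, tensMap_id, Category.id_comp, Category.comp_id]
  map_comp k l := tensorObj_hom_ext fun p => by
    rw [tensorι_homRight, tensorι_homRight_assoc, tensorι_homRight, ← Category.assoc,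
      ← tensMap_comp, NatTrans.comp_app, Category.comp_id]

instance (F : PSh P) : (tensorLeftWith F).Additive where
  map_add {G G' k l} := tensorObj_hom_ext fun p => by
    refine (tensorι_homRight F (k + l) p).trans (Eq.trans ?_ (Preadditive.comp_add _ _ _ _ _ _).symm)
    refine Eq.trans ?_ (congrArg₂ (· + ·) (tensorι_homRight F k p) (tensorι_homRight F l p)).symm
    refine Eq.trans ?_ (Preadditive.add_comp _ _ _ _ _ _)
    refine congrArg (· ≫ tensorι F G' p) (tens_hom_ext fun a b => ?_)
    exact TensorProduct.tmul_add a ((k.app p).hom b) ((l.app p).hom b)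

theorem tensorHom_homRight {F F' : PSh P} (k : F ⟶ F') {G G' : CoPSh P} (l : G ⟶ G') :
    tensorHom k G ≫ tensorHomRight F' l = tensorHomRight F l ≫ tensorHom k G' :=
  tensorObj_hom_ext fun p => by
    rw [tensorι_hom_assoc, tensorι_homRight, tensorι_homRight_assoc, tensorι_hom,
      ← Category.assoc, ← Category.assoc, ← tensMap_comp, ← tensMap_comp]
    simp only [Category.comp_id, Category.id_comp]

theorem tensorHomEquiv_homRight (F : PSh P) {G G' : CoPSh P} (k : G ⟶ G') {A : AddCommGrpCat.{u}}
    (t : tensorObj F G' ⟶ A) :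
    tensorHomEquiv F G A (tensorHomRight F k ≫ t) = tensorHomEquiv F G' A t ≫ homPShMap k A := by
  ext p : 2
  refine addCommGrp_hom_ext fun a => addCommGrp_hom_ext fun b => ?_
  exact congrArg (fun s => AddCommGrpCat.Hom.hom s (a ⊗ₜ[ℤ] b)) (tensorι_homRight_assoc F k p.unop t)

/-- By adjunction `Hom(F ⊗ Q, I) = Hom(Q, Hom(F, I))`. For injective `I` the functor `Hom(-, I)` is
exact, pointwise, and `Hom(Q, -)` is exact since `Q` is projective. -/
theorem tensorWith_exact (Q : CoPSh P) [Projective Q] (S : ShortComplex (PSh P)) (hS : S.Exact) :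
    (S.map (tensorWith Q)).Exact := by
  refine exact_of_injective_test _ fun I _ f hf => ?_
  have w : homCoPShMap S.g I ≫ homCoPShMap S.f I = 0 := by
    ext p : 2
    refine addCommGrp_hom_ext fun (k : S.X₃.obj (op p) ⟶ I) => ?_
    change S.f.app (op p) ≫ S.g.app (op p) ≫ k = 0
    rw [← Category.assoc, ← NatTrans.comp_app, S.zero]
    exact zero_comp
  have hex : (ShortComplex.mk _ _ w).Exact := (functor_exact_iff _).2 fun p =>
    homInto_exact I _ ((functor_exact_iff S).1 hS (op p)) (congrArg (fun t => NatTrans.app t p) w)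
  have hf' : tensorHomEquiv' S.X₂ Q I f ≫ homCoPShMap S.f I = 0 :=
    (tensorHomEquiv'_hom S.f Q f).symm.trans (congrArg _ hf)
  refine ⟨(tensorHomEquiv' _ _ _).symm (hex.liftFromProjective _ hf'),
    (tensorHomEquiv' _ _ _).injective ((tensorHomEquiv'_hom S.g Q _).trans ?_)⟩
  rw [Equiv.apply_symm_apply]
  exact hex.liftFromProjective_comp _ hf'

/-- The same argument with `Hom(Q ⊗ G, I) = Hom(Q, Hom(G, I))`. -/
theorem tensorLeftWith_exact (Q : PSh P) [Projective Q] (S : ShortComplex (CoPSh P))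
    (hS : S.Exact) : (S.map (tensorLeftWith Q)).Exact := by
  refine exact_of_injective_test _ fun I _ f hf => ?_
  have w : homPShMap S.g I ≫ homPShMap S.f I = 0 := by
    ext p : 2
    refine addCommGrp_hom_ext fun (k : S.X₃.obj p.unop ⟶ I) => ?_
    change S.f.app p.unop ≫ S.g.app p.unop ≫ k = 0
    rw [← Category.assoc, ← NatTrans.comp_app, S.zero]
    exact zero_comp
  have hex : (ShortComplex.mk _ _ w).Exact := (functor_exact_iff _).2 fun p =>
    homInto_exact I _ ((functor_exact_iff S).1 hS p.unop) (congrArg (fun t => NatTrans.app t p) w)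
  have hf' : tensorHomEquiv Q S.X₂ I f ≫ homPShMap S.f I = 0 :=
    (tensorHomEquiv_homRight Q S.f f).symm.trans (congrArg _ hf)
  refine ⟨(tensorHomEquiv _ _ _).symm (hex.liftFromProjective _ hf'),
    (tensorHomEquiv _ _ _).injective ((tensorHomEquiv_homRight Q S.g _).trans ?_)⟩
  rw [Equiv.apply_symm_apply]
  exact hex.liftFromProjective_comp _ hf'

instance (Q : CoPSh P) [Projective Q] : (tensorWith Q).PreservesHomology :=
  ((Functor.exact_tfae (tensorWith Q)).out 1 2).1 (tensorWith_exact Q)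

instance (Q : PSh P) [Projective Q] : (tensorLeftWith Q).PreservesHomology :=
  ((Functor.exact_tfae (tensorLeftWith Q)).out 1 2).1 (tensorLeftWith_exact Q)

/-- Copresheaves on `P` are presheaves on the order dual of `P`. -/
instance : EnoughProjectives (CoPSh P) := by
  let e : Pᵒᵈᵒᵖ ≌ P :=
    { functor := { obj := fun x => OrderDual.ofDual x.unop, map := fun f => homOfLE (leOfHom f.unop) }
      inverse := { obj := fun x => op (OrderDual.toDual x), map := fun f =>
        (homOfLE (OrderDual.toDual_le_toDual.2 (leOfHom f))).op }
      unitIso := Iso.refl _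
      counitIso := Iso.refl _ }
  exact (Equivalence.enoughProjectives_iff (e.congrLeft (E := AddCommGrpCat.{u}))).1
    (inferInstanceAs (EnoughProjectives (PSh Pᵒᵈ)))

end InternalHom

/-! ### Homology classes and resolutions of abelian groups, in terms of elements -/

section AbelianGroups

variable (S : ShortComplex AddCommGrpCat.{u})

/-- The homology class of a cycle. -/
noncomputable def homologyClass : AddMonoidHom.ker S.g.hom →+ S.homology :=
  (S.abCyclesIso.inv ≫ S.homologyπ).hom

theorem homologyClass_surjective : Function.Surjective (homologyClass S) :=
  (AddCommGrpCat.epi_iff_surjective (S.abCyclesIso.inv ≫ S.homologyπ)).1 inferInstance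

theorem homologyClass_eq_zero_iff (x : AddMonoidHom.ker S.g.hom) :
    homologyClass S x = 0 ↔ ∃ y, S.f.hom y = x.1 := by
  have hex := ShortComplex.ab_exact_iff_function_exact _ |>.1
    (ShortComplex.exact_of_g_is_cokernel (ShortComplex.mk _ _ S.toCycles_comp_homologyπ)
      S.homologyIsCokernel)
  have hi : Function.Injective S.iCycles.hom := (AddCommGrpCat.mono_iff_injective _).1 inferInstance
  refine (hex (S.abCyclesIso.inv.hom x)).trans (exists_congr fun y => ?_)
  rw [← S.abCyclesIso_inv_apply_iCycles x]
  have e : S.f.hom y = S.iCycles.hom (S.toCycles.hom y) :=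
    (congrArg (fun k => AddCommGrpCat.Hom.hom k y) S.toCycles_i).symm
  rw [e]
  exact hi.eq_iff.symm

variable {S}

theorem homologyMap_homologyClass {S' : ShortComplex AddCommGrpCat.{u}} (φ : S ⟶ S')
    (x : AddMonoidHom.ker S.g.hom) (h : φ.τ₂.hom x.1 ∈ AddMonoidHom.ker S'.g.hom) :
    (ShortComplex.homologyMap φ).hom (homologyClass S x) = homologyClass S' ⟨φ.τ₂.hom x.1, h⟩ := by
  have hi : Function.Injective S'.iCycles.hom := (AddCommGrpCat.mono_iff_injective _).1 inferInstance
  have e : (ShortComplex.cyclesMap φ).hom (S.abCyclesIso.inv.hom x) =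
      S'.abCyclesIso.inv.hom ⟨φ.τ₂.hom x.1, h⟩ := by
    apply hi
    refine Eq.trans ?_ (S'.abCyclesIso_inv_apply_iCycles _).symm
    refine (congrArg (fun k => AddCommGrpCat.Hom.hom k (S.abCyclesIso.inv.hom x))
      (ShortComplex.cyclesMap_i φ)).trans ?_
    exact congrArg φ.τ₂.hom (S.abCyclesIso_inv_apply_iCycles x)
  refine (congrArg (fun k => AddCommGrpCat.Hom.hom k (S.abCyclesIso.inv.hom x))
    (ShortComplex.homologyπ_naturality φ)).trans ?_
  exact congrArg S'.homologyπ.hom e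

theorem IsRes.surjective {K : ChainComplex AddCommGrpCat.{u} ℕ} {Z : AddCommGrpCat.{u}}
    {ε : K.X 0 ⟶ Z} (h : IsRes K ε) : Function.Surjective ε.hom :=
  (AddCommGrpCat.epi_iff_surjective ε).1 h.epi

theorem IsRes.eq_zero_iff {K : ChainComplex AddCommGrpCat.{u} ℕ} {Z : AddCommGrpCat.{u}}
    {ε : K.X 0 ⟶ Z} (h : IsRes K ε) (x : K.X 0) :
    ε.hom x = 0 ↔ ∃ y, (K.d 1 0).hom y = x :=
  (ShortComplex.ab_exact_iff_function_exact _).1 h.exact₀ x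

theorem IsRes.exists_of_eq_zero {K : ChainComplex AddCommGrpCat.{u} ℕ} {Z : AddCommGrpCat.{u}}
    {ε : K.X 0 ⟶ Z} (h : IsRes K ε) (n : ℕ) (x : K.X (n + 1)) (hx : (K.d (n + 1) n).hom x = 0) :
    ∃ y, (K.d (n + 2) (n + 1)).hom y = x :=
  (ShortComplex.ab_exact_iff _).1 (h.exactSucc n) x hx

end AbelianGroups

/-! ### Balancing of `Tor` and the hyper-`Tor` spectral sequence -/

section HyperTor

variable {B : Type u} [PartialOrder B]

/-- The natural transformation `- ⊗ G ⟶ - ⊗ G'` induced by a morphism of copresheaves. -/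
noncomputable def tensorWithMap {G G' : CoPSh B} (k : G ⟶ G') : tensorWith G ⟶ tensorWith G' where
  app F := tensorHomRight F k
  naturality _ _ l := tensorHom_homRight l k

theorem zsmul_zsmul_zero {A : Type*} [AddCommGroup A] (a b : ℤ) : a • b • (0 : A) = 0 := by simp

/-- The double complex `K_p ⊗ Q_q`. -/
noncomputable def tensorDoubleCx (K : ChainComplex (PSh B) ℕ) (Q : ChainComplex (CoPSh B) ℕ) :
    DoubleCx.{u} where
  M p q := tensorObj (K.X p) (Q.X q)
  v p q := (tensorHom (K.d (p + 1) p) (Q.X q)).hom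
  -- The two differentials of `K ⊗ Q` commute; the sign makes the squares anticommute.
  h p q := ((-1 : ℤ) ^ p) • (tensorHomRight (K.X p) (Q.d (q + 1) q)).hom
  v_v p q x := by
    have e : (tensorWith (Q.X q)).map (K.d (p + 2) (p + 1)) ≫ (tensorWith (Q.X q)).map (K.d (p + 1) p)
        = 0 := by
      rw [← Functor.map_comp, K.d_comp_d, Functor.map_zero]
    exact congrArg (fun k => AddCommGrpCat.Hom.hom k x) e
  h_h p q x := by
    have e : (tensorLeftWith (K.X p)).map (Q.d (q + 2) (q + 1)) ≫
        (tensorLeftWith (K.X p)).map (Q.d (q + 1) q) = 0 := by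
      rw [← Functor.map_comp, Q.d_comp_d, Functor.map_zero]
    have e' := congrArg (fun k => AddCommGrpCat.Hom.hom k x) e
    rw [AddMonoidHom.smul_apply, AddMonoidHom.smul_apply, map_zsmul]
    refine (congrArg (fun y : tensorObj (K.X p) (Q.X q) => (-1 : ℤ) ^ p • (-1 : ℤ) ^ p • y)
      e').trans ?_
    exact zsmul_zsmul_zero _ _
  anti p q x := by
    have e := congrArg (fun k => AddCommGrpCat.Hom.hom k x)
      (tensorHom_homRight (K.d (p + 1) p) (Q.d (q + 1) q))
    rw [AddMonoidHom.smul_apply, AddMonoidHom.smul_apply, map_zsmul, pow_succ, mul_neg_one, neg_smul,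
      neg_add_eq_zero]
    exact congrArg (fun y => (-1 : ℤ) ^ p • y) e.symm

variable (K : ChainComplex (PSh B) ℕ) (Q : ChainComplex (CoPSh B) ℕ)

theorem tensorDoubleCx_h_eq (p q : ℕ) (x : tensorObj (K.X p) (Q.X (q + 1))) :
    (tensorDoubleCx K Q).h p q x =
      (-1 : ℤ) ^ p • (tensorHomRight (K.X p) (Q.d (q + 1) q)).hom x := rfl

theorem neg_one_pow_mul_self (p : ℕ) : (-1 : ℤ) ^ p * (-1) ^ p = 1 := by
  rw [← mul_pow]
  simp

theorem neg_one_pow_smul_self {A : Type*} [AddCommGroup A] (p : ℕ) (x : A) :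
    (-1 : ℤ) ^ p • (-1 : ℤ) ^ p • x = x := by
  rw [smul_smul, neg_one_pow_mul_self, one_smul]

theorem eq_zero_of_neg_one_pow_smul {A : Type*} [AddCommGroup A] (p : ℕ) {x : A}
    (h : (-1 : ℤ) ^ p • x = 0) : x = 0 := by
  rw [← neg_one_pow_smul_self p x, h, smul_zero]

theorem neg_one_pow_smul_map_smul {A A' : Type*} [AddCommGroup A] [AddCommGroup A'] (f : A →+ A')
    (p : ℕ) (x : A) : (-1 : ℤ) ^ p • f ((-1 : ℤ) ^ p • x) = f x := by
  rw [map_zsmul, neg_one_pow_smul_self]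

/-- If `K` is a resolution of `X` and `Q` consists of projectives, then the total complex of
`K ⊗ Q` has the homology of `X ⊗ Q`. -/
theorem tensorDoubleCx_homology_left [∀ q, Projective (Q.X q)] {X : PSh B} {ε : K.X 0 ⟶ X}
    (h : IsRes K ε) (n : ℕ) :
    Nonempty ((((tensorLeftWith X).mapHomologicalComplex _).obj Q).homology n ≃+
      (tensorDoubleCx K Q).fd.H n) := by
  -- Each `Q_q` is flat, so `K ⊗ Q_q` is a resolution of `X ⊗ Q_q`. The sign of `h` is trivial in
  -- column `0`, where the augmentation is compared.
  have hT (q) := h.map (tensorWith (Q.X q))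
  refine (tensorDoubleCx K Q).total_homology_equiv
    (((tensorLeftWith X).mapHomologicalComplex _).obj Q) (fun q => (tensorHom ε (Q.X q)).hom) (fun q => (hT q).surjective)
    (fun q x => (hT q).eq_zero_iff x) (fun p q x hx => (hT q).exists_of_eq_zero p x hx)
    (fun q x => ?_) n
  refine (congrArg (tensorHom ε (Q.X q)).hom ((tensorDoubleCx_h_eq K Q 0 q x).trans
    (one_zsmul _))).trans ?_
  exact (congrArg (fun k => AddCommGrpCat.Hom.hom k x) (tensorHom_homRight ε (Q.d (q + 1) q))).symm

/-- If `Q` is a resolution of `G` and `K` consists of projectives, then the total complex of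
`K ⊗ Q` has the homology of `K ⊗ G`. -/
theorem tensorDoubleCx_homology_right [∀ p, Projective (K.X p)] {G : CoPSh B} {ε : Q.X 0 ⟶ G}
    (h : IsRes Q ε) (n : ℕ) :
    Nonempty ((((tensorWith G).mapHomologicalComplex _).obj K).homology n ≃+
      (tensorDoubleCx K Q).fd.H n) := by
  -- Each `K_p` is flat, so `K_p ⊗ Q` is a resolution of `K_p ⊗ G`. After the two directions are
  -- exchanged the signs sit on the resolving differential, where they change neither kernels nor
  -- images.
  have hT (p) := h.map (tensorLeftWith (K.X p))
  obtain ⟨e'⟩ := (tensorDoubleCx K Q).swap_H n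
  suffices Nonempty ((((tensorWith G).mapHomologicalComplex _).obj K).homology n ≃+
      (tensorDoubleCx K Q).swap.fd.H n) from ⟨this.some.trans e'⟩
  refine (tensorDoubleCx K Q).swap.total_homology_equiv
    (((tensorWith G).mapHomologicalComplex _).obj K)
    (fun p => (tensorHomRight (K.X p) ε).hom) (fun p => (hT p).surjective)
    (fun p x => ((hT p).eq_zero_iff x).trans ?_) (fun q p x hx => ?_)
    (fun p x => ?_) n
  · constructor
    · rintro ⟨y, rfl⟩
      exact ⟨(-1 : ℤ) ^ p • y, neg_one_pow_smul_map_smul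
        (tensorHomRight (K.X p) (Q.d 1 0)).hom p y⟩
    · rintro ⟨y, rfl⟩
      exact ⟨(-1 : ℤ) ^ p • y, map_zsmul _ _ _⟩
  · obtain ⟨y, hy⟩ := (hT p).exists_of_eq_zero q x (eq_zero_of_neg_one_pow_smul p hx)
    exact ⟨(-1 : ℤ) ^ p • y, (neg_one_pow_smul_map_smul
        (tensorHomRight (K.X p) (Q.d (q + 2) (q + 1))).hom p y).trans hy⟩
  · exact (congrArg (fun k => AddCommGrpCat.Hom.hom k x) (tensorHom_homRight (K.d (p + 1) p) ε))

/-- `Tor` can be computed with a projective resolution of the second argument. -/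
theorem tor_equiv_right {G : CoPSh B} (Q : ProjectiveResolution G) (X : PSh B) (n : ℕ) :
    Nonempty ((((tensorLeftWith X).mapHomologicalComplex _).obj Q.complex).homology n ≃+
      Tor n X G) := by
  let P := projectiveResolution X
  have := P.projective
  have := Q.projective
  -- With projective resolutions in both variables, the total complex of `P ⊗ Q` computes both `X ⊗
  -- Q` and `P ⊗ G`.
  obtain ⟨e⟩ := tensorDoubleCx_homology_left P.complex Q.complex (isRes_aug P) n
  obtain ⟨e'⟩ := tensorDoubleCx_homology_right P.complex Q.complex (isRes_aug Q) n
  exact ⟨(e.trans e'.symm).trans (P.isoLeftDerivedObj (tensorWith G) n).symm.addCommGroupIsoToAddEquiv⟩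

/-- The index `j` is arbitrary because the short complex of `K` at `p` uses the next index, which is
a default value when `p = 0`. -/
theorem tensorDoubleCx_map_d_eq_zero {p q : ℕ} {m : tensorObj (K.X p) (Q.X q)}
    (hm : m ∈ (tensorDoubleCx K Q).vcyc p q) (j : ℕ) :
    ((tensorWith (Q.X q)).map (K.d p j)).hom m = 0 := by
  by_cases hj : j + 1 = p
  · subst hj
    exact hm
  · rw [K.shape _ _ hj, Functor.map_zero]
    rfl

/-- The class of a cycle of `K_p ⊗ Q_q` in `H_p(K) ⊗ Q_q`. -/
noncomputable def tensorClass [∀ q, Projective (Q.X q)] (p q : ℕ) :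
    (tensorDoubleCx K Q).vcyc p q →+ tensorObj (K.homology p) (Q.X q) :=
  ((K.sc p).mapHomologyIso (tensorWith (Q.X q))).hom.hom.comp
    ((homologyClass ((K.sc p).map (tensorWith (Q.X q)))).comp
      (AddSubgroup.inclusion fun _ hm => tensorDoubleCx_map_d_eq_zero K Q hm _))

theorem tensorClass_surjective [∀ q, Projective (Q.X q)] (p q : ℕ) :
    Function.Surjective (tensorClass K Q p q) := by
  refine (((K.sc p).mapHomologyIso
    (tensorWith (Q.X q))).addCommGroupIsoToAddEquiv.surjective.comp
      (homologyClass_surjective _)).comp fun x => ⟨⟨x.1, ?_⟩, rfl⟩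
  cases p with
  | zero => trivial
  | succ p =>
    have hx : ((tensorWith (Q.X q)).map (K.d (p + 1) ((ComplexShape.down ℕ).next (p + 1)))).hom x.1
      = 0 := x.2
    rw [ChainComplex.next_nat_succ] at hx
    exact hx

theorem tensorClass_eq_zero_iff [∀ q, Projective (Q.X q)] (p q : ℕ)
    (x : (tensorDoubleCx K Q).vcyc p q) :
    tensorClass K Q p q x = 0 ↔ ∃ y, (tensorDoubleCx K Q).v p q y = x.1 := by
  refine ((map_eq_zero_iff _ ((K.sc p).mapHomologyIso
    (tensorWith (Q.X q))).addCommGroupIsoToAddEquiv.injective).trans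
      (homologyClass_eq_zero_iff _ _)).trans ?_
  have (k : ℕ) (hk : k = p + 1) : (∃ y, ((tensorWith (Q.X q)).map (K.d k p)).hom y = x.1) ↔
      ∃ y, (tensorDoubleCx K Q).v p q y = x.1 := by
    subst hk
    rfl
  exact this _ (ChainComplex.prev ℕ p)

/-- The isomorphism `H_p(K ⊗ Q_q) ≅ H_p(K) ⊗ Q_q` is natural with respect to the transformation `- ⊗
Q_{q+1} ⟶ - ⊗ Q_q`; the sign is the one built into `h`. -/
theorem tensorClass_h [∀ q, Projective (Q.X q)] (p q : ℕ)
    (x : (tensorDoubleCx K Q).vcyc p (q + 1)) :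
    tensorClass K Q p q ⟨(tensorDoubleCx K Q).h p q x.1, DoubleCx.h_mem_vcyc x.2⟩ =
      (-1 : ℤ) ^ p • (tensorHomRight (K.homology p) (Q.d (q + 1) q)).hom
        (tensorClass K Q p (q + 1) x) := by
  let τ := tensorWithMap (Q.d (q + 1) q)
  have hmem : (tensorHomRight (K.X p) (Q.d (q + 1) q)).hom x.1 ∈ (tensorDoubleCx K Q).vcyc p q := by
    have := zsmul_mem (DoubleCx.h_mem_vcyc x.2) ((-1 : ℤ) ^ p)
    have e : (-1 : ℤ) ^ p • (tensorDoubleCx K Q).h p q x.1 =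
        (tensorHomRight (K.X p) (Q.d (q + 1) q)).hom x.1 := by
      exact neg_one_pow_smul_self p _
    rwa [e] at this
  have e1 : tensorClass K Q p q ⟨(tensorDoubleCx K Q).h p q x.1, DoubleCx.h_mem_vcyc x.2⟩ =
      (-1 : ℤ) ^ p • tensorClass K Q p q ⟨_, hmem⟩ := by
    rw [← map_zsmul]
    rfl
  rw [e1]
  congr 1
  have e2 : ((K.sc p).mapHomologyIso (tensorWith (Q.X (q + 1)))).hom ≫ τ.app (K.sc p).homology =
      ShortComplex.homologyMap ((K.sc p).mapNatTrans τ) ≫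
        ((K.sc p).mapHomologyIso (tensorWith (Q.X q))).hom := by
    rw [NatTrans.app_homology, Iso.hom_inv_id_assoc]
  let c : AddMonoidHom.ker ((K.sc p).map (tensorWith (Q.X (q + 1)))).g.hom :=
    ⟨x.1, tensorDoubleCx_map_d_eq_zero K Q x.2 _⟩
  have e3 := congrArg (fun k => AddCommGrpCat.Hom.hom k (homologyClass _ c)) e2
  refine Eq.trans ?_ e3.symm
  exact congrArg ((K.sc p).mapHomologyIso (tensorWith (Q.X q))).hom.hom
    (homologyMap_homologyClass ((K.sc p).mapNatTrans τ) c
      (tensorDoubleCx_map_d_eq_zero K Q hmem _)).symm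

/-- The hyper-`Tor` spectral sequence of a complex of projective presheaves. -/
theorem exists_hyperTor_specSeq [∀ p, Projective (K.X p)] (G : CoPSh B) (H : ℕ → AddCommGrpCat.{u})
    (e : ∀ n, H n ≅ (((tensorWith G).mapHomologicalComplex _).obj K).homology n) :
    ∃ E : SpecSeq.{u}, (∀ p q : ℕ, Nonempty ((E.page 2 le_rfl).X (p, q) ≅ Tor q (K.homology p) G)) ∧
      Converges E H := by
  let Q := projectiveResolution G
  have := Q.projective
  refine ⟨(tensorDoubleCx K Q.complex).fd.specSeq, fun p q => ?_,
    FiltDiff.converges _ _ fun n =>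
      (tensorDoubleCx_homology_right K Q.complex (isRes_aug Q) n).map
        (e n).addCommGroupIsoToAddEquiv.trans⟩
  obtain ⟨e⟩ := DoubleCx.secondPage_equiv (D := tensorDoubleCx K Q.complex) p
    (((tensorLeftWith (K.homology p)).mapHomologicalComplex _).obj Q.complex)
    (tensorClass K Q.complex p) (tensorClass_surjective K Q.complex p)
    (tensorClass_eq_zero_iff K Q.complex p) ((-1) ^ p) (neg_one_pow_mul_self p)
    (tensorClass_h K Q.complex p) q
  obtain ⟨e'⟩ := tor_equiv_right Q (K.homology p) q
  exact ⟨(e.symm.trans e').toAddCommGrpIso⟩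

end HyperTor

/-! ### Induced maps of derived functors, for arbitrary resolutions -/

section DerivedMap

theorem aug_mapProjectiveResolution {C D : Type*} [Category* C] [Category* D] [Abelian C]
    [Abelian D] (R : D ⥤ C) [R.Additive] [R.PreservesHomology] [R.PreservesProjectiveObjects]
    {Y : D} (Q : ProjectiveResolution Y) : aug (R.mapProjectiveResolution Q) = R.map (aug Q) := by
  simp only [aug, Functor.mapProjectiveResolution_π, HomologicalComplex.comp_f]
  simp
  exact Category.comp_id _

theorem comp_iso_square_aux {A : Type*} [Category* A] {X₀ X₁ X₁' X₂ X₃ Y : A} (i : X₀ ⟶ X₁)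
    {f : X₁ ⟶ X₂} (j : Y ≅ X₂) {b : X₂ ⟶ X₃} {a : X₁ ⟶ X₁'} {g : X₁' ⟶ X₃} (e : f ≫ b = a ≫ g) :
    (i ≫ f ≫ j.inv) ≫ j.hom ≫ b = (i ≫ a) ≫ g := by
  simp [e]

variable {C D A : Type*} [Category* C] [Category* D] [Category* A] [Abelian C] [Abelian D]
  [Abelian A] {R : D ⥤ C} [R.Additive] [R.PreservesHomology] {T : C ⥤ A} [T.Additive]
  {T' : D ⥤ A} [T'.Additive] (α : Comparison R T T') [HasProjectiveResolutions C]
  [HasProjectiveResolutions D]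

/-- The map `derivedMap` can be computed with arbitrary projective resolutions. -/
theorem derivedMap_comp_isoLeftDerivedObj {X : C} {Y : D} (k : X ⟶ R.obj Y) (n : ℕ)
    (P : ProjectiveResolution X) (Q : ProjectiveResolution Y)
    (φ : RelHom R P.complex Q.complex) (hφ : φ.f 0 ≫ R.map (aug Q) = aug P ≫ k) :
    derivedMap α k n ≫ (Q.isoLeftDerivedObj T' n).hom =
      (P.isoLeftDerivedObj T n).hom ≫ HomologicalComplex.homologyMap (chainComp α φ) n := by
  let P₀ := projectiveResolution X
  let Q₀ := projectiveResolution Y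
  obtain ⟨ψ, hψ⟩ := exists_resLift P₀ Q₀ k
  have hp := P₀.projective
  have hq := Q₀.projective
  -- The isomorphisms with the derived functors are induced by the comparison maps `a` and `b` from
  -- the chosen resolutions to the given ones.
  obtain ⟨a, ha⟩ := (isRes_aug P).exists_lift (isRes_aug P₀).w (𝟙 X)
  obtain ⟨b, hb⟩ := (isRes_aug Q).exists_lift (isRes_aug Q₀).w (𝟙 Y)
  have ha' := P₀.isoLeftDerivedObj_hom_naturality (𝟙 X) P a ha T n
  have hb' := Q₀.isoLeftDerivedObj_hom_naturality (𝟙 Y) Q b hb T' n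
  rw [CategoryTheory.Functor.map_id, Category.id_comp] at ha' hb'
  let χ : RelHom R P₀.complex Q.complex :=
    { f := fun i => ψ.f i ≫ R.map (b.f i)
      comm := fun i j => by
        rw [Category.assoc, ← R.map_comp, b.comm, R.map_comp, reassoc_of% ψ.comm] }
  let χ' : RelHom R P₀.complex Q.complex :=
    { f := fun i => a.f i ≫ φ.f i
      comm := fun i j => by
        rw [Category.assoc, φ.comm, reassoc_of% a.comm] }
  -- Going through `ψ` and `b`, or through `a` and `φ`, gives two lifts of `k` to a map `P₀ ⟶ R(Q)`;
  -- these are homotopic.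
  obtain ⟨H⟩ := ((isRes_aug Q).map R).homotopy χ.hom χ'.hom (by
    change (ψ.f 0 ≫ R.map (b.f 0)) ≫ R.map (aug Q) = (a.f 0 ≫ φ.f 0) ≫ R.map (aug Q)
    rw [Category.assoc, Category.assoc, ← R.map_comp, hb, hφ, Category.comp_id, hψ,
      reassoc_of% ha])
  have e := chainComp_homology α H n
  have e1 : chainComp α χ = chainComp α ψ ≫ (T'.mapHomologicalComplex _).map b := by
    ext i
    have : T.map (ψ.f i ≫ R.map (b.f i)) ≫ α.app _ = (T.map (ψ.f i) ≫ α.app _) ≫ T'.map (b.f i) := by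
      rw [T.map_comp, Category.assoc, Category.assoc, α.naturality]
    exact this
  have e2 : chainComp α χ' = (T.mapHomologicalComplex _).map a ≫ chainComp α φ := by
    ext i
    have : T.map (a.f i ≫ φ.f i) ≫ α.app _ = T.map (a.f i) ≫ T.map (φ.f i) ≫ α.app _ := by
      rw [T.map_comp, Category.assoc]
    exact this
  rw [e1, e2, HomologicalComplex.homologyMap_comp, HomologicalComplex.homologyMap_comp] at e
  rw [derivedMap_eq α k n ψ hψ, ha', hb']
  exact comp_iso_square_aux _ (Q₀.isoLeftDerivedObj T' n) e

end DerivedMap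

/-! ### The unit of the tensor product -/

section Unit

/-- The isomorphism `A ⊗ ℤ ≅ A`. -/
noncomputable def tensUnitIso (A : AddCommGrpCat.{u}) :
    tens A (AddCommGrpCat.of (ULift.{u} ℤ)) ≅ A :=
  AddEquiv.toAddCommGrpIso (X := tens A (AddCommGrpCat.of (ULift.{u} ℤ))) (Y := A)
    ((TensorProduct.congr (LinearEquiv.refl ℤ A)
      (AddEquiv.ulift (α := ℤ)).toIntLinearEquiv).trans (TensorProduct.rid ℤ A)).toAddEquiv

theorem tensUnitIso_inv_comp_tensMap {A A' : AddCommGrpCat.{u}} (f : A ⟶ A') :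
    (tensUnitIso A).inv ≫ tensMap f (𝟙 _) = f ≫ (tensUnitIso A').inv := by
  ext a
  rfl

theorem tensMap_comp_tensUnitIso_hom {A A' : AddCommGrpCat.{u}} (f : A ⟶ A') :
    tensMap f (𝟙 _) ≫ (tensUnitIso A').hom = (tensUnitIso A).hom ≫ f := by
  rw [← Iso.inv_comp_eq, ← Category.assoc, tensUnitIso_inv_comp_tensMap, Category.assoc,
    Iso.inv_hom_id, Category.comp_id]

end Unit

/-! ### Push-forward along the projection and the projection formula -/

section Push

variable {B : Type u} [PartialOrder B] {Ψ : Bᵒᵖ ⥤ PartOrd.{u}}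

/-- The restriction map `H_0(Ψ(y); F) ⟶ H_0(Ψ(x); F)`. -/
noncomputable def pushMap (F : PSh (Total Ψ)) {x y : B} (h : x ≤ y) :
    tensorObj (fibre F y) (constZ _) ⟶ tensorObj (fibre F x) (constZ _) :=
  tensorMap (fibreHom F (trans Ψ h) (incl_trans_le h)) (constZHom _)

theorem tensorι_pushMap (F : PSh (Total Ψ)) {x y : B} (h : x ≤ y) (b : Ψ.obj (op y)) :
    tensorι (fibre F y) (constZ _) b ≫ pushMap F h =
      tensMap (F.map (homOfLE (incl_trans_le h b)).op) (𝟙 _) ≫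
        tensorι (fibre F x) (constZ _) (trans Ψ h b) :=
  tensorι_map _ _ b

theorem pushMap_self (F : PSh (Total Ψ)) {x : B} (h : x ≤ x) : pushMap F h = 𝟙 _ :=
  tensorMap_self (fun b => (trans_self h b).le) _ (fun _ => rfl) _ fun _ => Category.comp_id _

/-- The composite enters as a map `g''` with an equation, since functoriality of `Ψ` provides only
an equality of monotone maps, which is then substituted. -/
theorem fibreHom_tensorMap_comp (F : PSh (Total Ψ)) {x y z : B} (g : Ψ.obj (op y) →o Ψ.obj (op x))
    (hg : ∀ b, incl Ψ x (g b) ≤ incl Ψ y b) (g' : Ψ.obj (op z) →o Ψ.obj (op y))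
    (hg' : ∀ b, incl Ψ y (g' b) ≤ incl Ψ z b) (g'' : Ψ.obj (op z) →o Ψ.obj (op x))
    (hg'' : ∀ b, incl Ψ x (g'' b) ≤ incl Ψ z b) (h : g'' = g.comp g') :
    tensorMap (fibreHom F g'' hg'') (constZHom _) =
      tensorMap (fibreHom F g' hg') (constZHom _) ≫ tensorMap (fibreHom F g hg) (constZHom _) := by
  subst h
  rw [tensorMap_comp]
  refine congrArg (fun m => tensorMap m (constZHom _)) ?_
  ext b : 2
  exact F.map_comp (homOfLE (hg' b)).op (homOfLE (hg (g' b))).op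

theorem pushMap_comp (F : PSh (Total Ψ)) {x y z : B} (h : x ≤ y) (h' : y ≤ z) :
    pushMap F (h.trans h') = pushMap F h' ≫ pushMap F h :=
  fibreHom_tensorMap_comp F _ _ _ _ _ _ (trans_comp h h')

theorem pushMap_naturality {F F' : PSh (Total Ψ)} (k : F ⟶ F') {x y : B} (h : x ≤ y) :
    pushMap F h ≫ tensorHom ((pull (incl Ψ x)).map k) _ =
      tensorHom ((pull (incl Ψ y)).map k) _ ≫ pushMap F' h := by
  -- Both composites are induced by this one homomorphism over `Ψ(x ≤ y)`.
  let m : FHom (trans Ψ h) (fibre F y) (fibre F' x) :=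
    (fibreHom F (trans Ψ h) (incl_trans_le h)).comp (g := OrderHom.id)
      ⟨fun p => k.app (op (incl Ψ x p)), fun _ => k.naturality _⟩
  refine (tensorMap_hom _ _ m _ fun _ => rfl).trans (tensorHom_map _ _ m _ fun b => ?_).symm
  exact (k.naturality (homOfLE (incl_trans_le h b)).op).symm

/-- The push-forward of presheaves along the projection `π : S → B`; it sends `F` to the presheaf
`x ↦ F|_{Ψ(x)} ⊗ ℤ`. -/
noncomputable def push (Ψ : Bᵒᵖ ⥤ PartOrd.{u}) : PSh (Total Ψ) ⥤ PSh B where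
  obj F :=
    { obj := fun x => tensorObj (fibre F x.unop) (constZ _)
      map := fun h => pushMap F (leOfHom h.unop)
      map_id := fun _ => pushMap_self F _
      map_comp := fun h h' => pushMap_comp F (leOfHom h'.unop) (leOfHom h.unop) }
  map k :=
    { app := fun x => tensorHom ((pull (incl Ψ x.unop)).map k) _
      naturality := fun _ _ h => pushMap_naturality k (leOfHom h.unop) }
  map_id F := by
    ext x : 2
    exact (tensorWith (constZ _)).map_id (fibre F x.unop)
  map_comp k k' := by
    ext x : 2
    exact (tensorWith (constZ _)).map_comp ((pull (incl Ψ x.unop)).map k)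
      ((pull (incl Ψ x.unop)).map k')

instance : (push Ψ).Additive where
  map_add {F F' k l} := by
    ext x : 2
    exact tensorHom_add ((pull (incl Ψ x.unop)).map k) ((pull (incl Ψ x.unop)).map l) _

/-- The map `F(s) ⟶ (π_! F)(π(s))`. -/
noncomputable def toPush (F : PSh (Total Ψ)) (s : Total Ψ) :
    F.obj (op s) ⟶ ((push Ψ).obj F).obj (op s.base) :=
  (tensUnitIso _).inv ≫ tensorι (fibre F s.base) (constZ _) s.pt

/-- A relation `t ≤ s` factors through `Ψ(π(t) ≤ π(s))(s)`. The step inside the fibre of `t` is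
absorbed by the relations of the tensor product, and the step between fibres is the restriction map
of `π_! F`. -/
theorem toPush_naturality (F : PSh (Total Ψ)) {s t : Total Ψ} (h : t ≤ s) :
    F.map (homOfLE h).op ≫ toPush F t =
      toPush F s ≫ ((push Ψ).obj F).map (homOfLE ((proj Ψ).monotone h)).op := by
  have e1 : toPush F s ≫ ((push Ψ).obj F).map (homOfLE ((proj Ψ).monotone h)).op =
      (tensUnitIso _).inv ≫ tensMap (F.map (homOfLE (incl_trans_le h.1 s.pt)).op) (𝟙 _) ≫
        tensorι (fibre F t.base) (constZ _) (trans Ψ h.1 s.pt) :=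
    (Category.assoc _ _ _).trans (congrArg ((tensUnitIso _).inv ≫ ·) (tensorι_pushMap F h.1 s.pt))
  have e2 : F.map (homOfLE h).op = F.map (homOfLE (incl_trans_le h.1 s.pt)).op ≫
      (fibre F t.base).map (homOfLE h.2).op :=
    F.map_comp (homOfLE (incl_trans_le h.1 s.pt)).op (homOfLE ((incl Ψ t.base).monotone h.2)).op
  have e3 := tensorι_condition (fibre F t.base) (constZ _) h.2
  rw [e1]
  refine addCommGrp_hom_ext fun a => ?_
  refine (congrArg (fun z => (tensorι (fibre F t.base) (constZ _) t.pt).hom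
    (z ⊗ₜ[ℤ] (ULift.up 1 : ULift.{u} ℤ))) (congrArg (fun k => k.hom a) e2)).trans ?_
  exact congrArg (fun k => k.hom ((F.map (homOfLE (incl_trans_le h.1 s.pt)).op).hom a ⊗ₜ[ℤ]
    (ULift.up 1 : ULift.{u} ℤ))) e3

theorem push_hom_ext {F : PSh (Total Ψ)} {E : PSh B} {f g : (push Ψ).obj F ⟶ E}
    (h : ∀ s, toPush F s ≫ f.app (op s.base) = toPush F s ≫ g.app (op s.base)) : f = g := by
  ext x : 2
  refine tensorObj_hom_ext fun b => ?_
  exact (cancel_epi (tensUnitIso _).inv).1 ((Category.assoc _ _ _).symm.trans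
    ((h ⟨x.unop, b⟩).trans (Category.assoc _ _ _)))

theorem comp_tensUnitIso_aux {A A' C : AddCommGrpCat.{u}} {f : A ⟶ A'} {k : A' ⟶ C} {l : A ⟶ C}
    (h : f ≫ k = l) :
    tensMap f (𝟙 _) ≫ (tensUnitIso A').hom ≫ k = (tensUnitIso A).hom ≫ l := by
  rw [← Category.assoc, tensMap_comp_tensUnitIso_hom, Category.assoc, h]

/-- The map `(π_! F)(x) ⟶ E(x)` induced by a morphism `F ⟶ π^* E`. -/
noncomputable def pushDescAt {F : PSh (Total Ψ)} {E : PSh B} (g : F ⟶ (pull (proj Ψ)).obj E)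
    (x : B) : tensorObj (fibre F x) (constZ _) ⟶ E.obj (op x) :=
  tensorDesc (fun b => (tensUnitIso (F.obj (op (incl Ψ x b)))).hom ≫ g.app (op (incl Ψ x b)))
    fun b a h => by
      have e := comp_tensUnitIso_aux
        ((g.naturality (homOfLE ((incl Ψ x).monotone h)).op).trans
          ((congrArg (_ ≫ ·) (E.map_id (op x))).trans (Category.comp_id _)))
      have e' : tensMap (𝟙 ((fibre F x).obj (op a))) ((constZ _).map (homOfLE h)) = 𝟙 _ :=
        tensMap_id _ _
      rw [e']
      exact e.trans (Category.id_comp _).symm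

theorem tensorι_pushDescAt {F : PSh (Total Ψ)} {E : PSh B} (g : F ⟶ (pull (proj Ψ)).obj E)
    (x : B) (b : Ψ.obj (op x)) : tensorι (fibre F x) (constZ _) b ≫ pushDescAt g x =
      (tensUnitIso (F.obj (op (incl Ψ x b)))).hom ≫ g.app (op (incl Ψ x b)) :=
  tensorι_desc _ _ b

theorem pushMap_pushDescAt {F : PSh (Total Ψ)} {E : PSh B} (g : F ⟶ (pull (proj Ψ)).obj E)
    {x y : B} (h : x ≤ y) :
    pushMap F h ≫ pushDescAt g x = pushDescAt g y ≫ E.map (homOfLE h).op :=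
  tensorObj_hom_ext fun b => by
    refine (Category.assoc _ _ _).symm.trans ?_
    refine (congrArg (· ≫ pushDescAt g x) (tensorι_pushMap F h b)).trans ?_
    refine (Category.assoc _ _ _).trans ?_
    refine (congrArg (_ ≫ ·) (tensorι_pushDescAt g x (trans Ψ h b))).trans ?_
    refine (comp_tensUnitIso_aux (g.naturality (homOfLE (incl_trans_le h b)).op)).trans ?_
    refine (Category.assoc _ _ _).symm.trans ?_
    refine (congrArg (· ≫ E.map (homOfLE h).op) (tensorι_pushDescAt g y b).symm).trans ?_
    exact Category.assoc _ _ _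

/-- The morphism `π_! F ⟶ E` induced by a morphism `F ⟶ π^* E`. -/
noncomputable def pushDesc {F : PSh (Total Ψ)} {E : PSh B} (g : F ⟶ (pull (proj Ψ)).obj E) :
    (push Ψ).obj F ⟶ E where
  app x := pushDescAt g x.unop
  naturality _ _ h := pushMap_pushDescAt g (leOfHom h.unop)

theorem toPush_desc {F : PSh (Total Ψ)} {E : PSh B} (g : F ⟶ (pull (proj Ψ)).obj E)
    (s : Total Ψ) : toPush F s ≫ (pushDesc g).app (op s.base) = g.app (op s) :=
  (Category.assoc _ _ _).trans ((congrArg (_ ≫ ·) (tensorι_pushDescAt g s.base s.pt)).trans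
    (Iso.inv_hom_id_assoc _ _))

theorem toPush_map {F F' : PSh (Total Ψ)} (k : F ⟶ F') (s : Total Ψ) :
    toPush F s ≫ ((push Ψ).map k).app (op s.base) = k.app (op s) ≫ toPush F' s := by
  have e : toPush F s ≫ ((push Ψ).map k).app (op s.base) =
      (tensUnitIso _).inv ≫ tensMap (k.app (op s)) (𝟙 _) ≫
        tensorι (fibre F' s.base) (constZ _) s.pt :=
    (Category.assoc _ _ _).trans (congrArg (_ ≫ ·)
      (tensorι_hom ((pull (incl Ψ s.base)).map k) (constZ _) s.pt))
  exact e.trans (addCommGrp_hom_ext fun a => rfl)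

/-- Morphisms `π_! F ⟶ E` are morphisms `F ⟶ π^* E`. -/
noncomputable def pushHomEquiv (F : PSh (Total Ψ)) (E : PSh B) :
    ((push Ψ).obj F ⟶ E) ≃ (F ⟶ (pull (proj Ψ)).obj E) where
  toFun f :=
    { app := fun s => toPush F s.unop ≫ f.app (op s.unop.base)
      naturality := fun s t h => comm_paste (toPush_naturality F (leOfHom h.unop))
        (f.naturality (homOfLE ((proj Ψ).monotone (leOfHom h.unop))).op) }
  invFun g := pushDesc g
  left_inv f := push_hom_ext fun s => toPush_desc _ s
  right_inv g := by
    ext s : 2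
    exact toPush_desc g s.unop

/-- The push-forward is left adjoint to the pull-back. -/
noncomputable def pushAdj (Ψ : Bᵒᵖ ⥤ PartOrd.{u}) : push Ψ ⊣ pull (proj Ψ) :=
  Adjunction.mkOfHomEquiv
    { homEquiv := pushHomEquiv
      homEquiv_naturality_left_symm := fun {F' F E} k g => push_hom_ext fun s => by
        refine (toPush_desc (k ≫ g) s).trans (Eq.symm ?_)
        refine (Category.assoc _ _ _).symm.trans ?_
        refine (congrArg (· ≫ (pushDesc g).app (op s.base)) (toPush_map k s)).trans ?_
        exact (Category.assoc _ _ _).trans (congrArg (k.app (op s) ≫ ·) (toPush_desc g s))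
      homEquiv_naturality_right := fun f g => by
        ext s : 2
        exact (Category.assoc _ _ _).symm }

/-- The right adjoint `π^*` preserves epimorphisms, as these are detected pointwise. -/
theorem projective_push (F : PSh (Total Ψ)) [Projective F] : Projective ((push Ψ).obj F) :=
  (pushAdj Ψ).map_projective F inferInstance

/-- The projection formula `F ⊗ π^* G ≅ π_! F ⊗ G`. -/
noncomputable def projectionFormula (Ψ : Bᵒᵖ ⥤ PartOrd.{u}) (G : CoPSh B) :
    tensorWith ((copull (proj Ψ)).obj G) ≅ push Ψ ⋙ tensorWith G :=
  -- Both sides are left adjoint to `A ↦ Hom(π^* G, A)`, which is the same as `A ↦ π^* Hom(G, A)`.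
  (tensorAdj ((copull (proj Ψ)).obj G)).leftAdjointUniq ((pushAdj Ψ).comp (tensorAdj G))

end Push

/-! ### Restriction to a fibre preserves projectives -/

section Restriction

variable {B : Type u} [PartialOrder B] {Ψ : Bᵒᵖ ⥤ PartOrd.{u}} {x : B}

theorem trans_le_trans {s t : Total Ψ} (h : t ≤ s) (h' : x ≤ t.base) :
    trans Ψ h' t.pt ≤ trans Ψ (h'.trans h.1) s.pt := by
  rw [trans_comp h' h.1]
  exact (trans Ψ h').monotone h.2

theorem trans_pt_le (b : Ψ.obj (op x)) (h : x ≤ x) : b ≤ trans Ψ h b := (trans_self h b).ge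

/-- The right adjoint of the restriction to the fibre over `x`: it sends `X` to the presheaf with
value `X(Ψ(x ≤ y)(b))` at `b ∈ Ψ(y)` if `x ≤ y`, and zero otherwise. -/
def coind (x : B) : PSh (Ψ.obj (op x)) ⥤ PSh (Total Ψ) where
  obj X :=
    { obj := fun s => AddCommGrpCat.of
        (∀ h : PLift (x ≤ s.unop.base), X.obj (op (trans Ψ h.1 s.unop.pt)))
      map := fun {s t} l => AddCommGrpCat.ofHom
        { toFun := fun m h => (X.map (homOfLE (trans_le_trans (leOfHom l.unop) h.1)).op).hom
            (m ⟨h.1.trans (leOfHom l.unop).1⟩)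
          map_zero' := by
            ext h
            exact map_zero _
          map_add' := fun m m' => by
            ext h
            exact map_add _ _ _ }
      map_id := fun s => addCommGrp_hom_ext fun m => funext fun h =>
        congrArg (fun k => k.hom (m h)) (X.map_id _)
      map_comp := fun {s t r} l l' => addCommGrp_hom_ext fun m => funext fun h =>
        congrArg (fun k => k.hom (m ⟨(h.1.trans (leOfHom l'.unop).1).trans (leOfHom l.unop).1⟩))
          (X.map_comp
            (homOfLE (trans_le_trans (leOfHom l.unop) (h.1.trans (leOfHom l'.unop).1))).op
            (homOfLE (trans_le_trans (leOfHom l'.unop) h.1)).op) }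
  map k :=
    { app := fun s => AddCommGrpCat.ofHom
        { toFun := fun m h => (k.app _).hom (m h)
          map_zero' := by
            ext h
            exact map_zero _
          map_add' := fun m m' => by
            ext h
            exact map_add _ _ _ }
      naturality := fun {s t} l => addCommGrp_hom_ext fun m => funext fun h =>
        congrArg (fun j => j.hom (m ⟨h.1.trans (leOfHom l.unop).1⟩))
          (k.naturality (homOfLE (trans_le_trans (leOfHom l.unop) h.1)).op) }

/-- A component of the coinduced presheaf. -/
def coindProj (X : PSh (Ψ.obj (op x))) (s : Total Ψ) (h : x ≤ s.base) :
    ((coind x).obj X).obj (op s) ⟶ X.obj (op (trans Ψ h s.pt)) :=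
  AddCommGrpCat.ofHom (Pi.evalAddMonoidHom (fun h : PLift (x ≤ s.base) =>
    X.obj (op (trans Ψ h.1 s.pt))) ⟨h⟩)

theorem coind_map_proj (X : PSh (Ψ.obj (op x))) {s t : Total Ψ} (l : t ≤ s) (h : x ≤ t.base) :
    ((coind x).obj X).map (homOfLE l).op ≫ coindProj X t h =
      coindProj X s (h.trans l.1) ≫ X.map (homOfLE (trans_le_trans l h)).op := rfl

/-- The morphism `F ⟶ coind X` given by a morphism `F|_{Ψ(x)} ⟶ X`. -/
def coindLift {F : PSh (Total Ψ)} {X : PSh (Ψ.obj (op x))} (f : fibre F x ⟶ X) :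
    F ⟶ (coind x).obj X where
  app s := AddCommGrpCat.ofHom (AddMonoidHom.pi fun h : PLift (x ≤ s.unop.base) =>
    (F.map (homOfLE (incl_trans_le h.1 s.unop.pt)).op ≫ f.app (op (trans Ψ h.1 s.unop.pt))).hom)
  naturality s t l := addCommGrp_hom_ext fun a => funext fun h => by
    have e := congrArg (fun j => j.hom a)
      (map_square F l (homOfLE (incl_trans_le h.1 t.unop.pt)).op
        (homOfLE (incl_trans_le (h.1.trans (leOfHom l.unop).1) s.unop.pt)).op
        (homOfLE ((incl Ψ x).monotone (trans_le_trans (leOfHom l.unop) h.1))).op)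
    refine (congrArg (f.app (op (trans Ψ h.1 t.unop.pt))).hom e).trans ?_
    exact congrArg (fun j => j.hom ((F.map (homOfLE (incl_trans_le
      (h.1.trans (leOfHom l.unop).1) s.unop.pt)).op).hom a))
      (f.naturality (homOfLE (trans_le_trans (leOfHom l.unop) h.1)).op)

/-- The morphism `F|_{Ψ(x)} ⟶ X` given by a morphism `F ⟶ coind X`. -/
def coindDesc {F : PSh (Total Ψ)} {X : PSh (Ψ.obj (op x))} (g : F ⟶ (coind x).obj X) :
    fibre F x ⟶ X where
  app b := g.app (op (incl Ψ x b.unop)) ≫ coindProj X (incl Ψ x b.unop) le_rfl ≫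
    X.map (homOfLE (trans_pt_le b.unop le_rfl)).op
  naturality b c l := by
    refine (comm_paste (g.naturality (homOfLE ((incl Ψ x).monotone (leOfHom l.unop))).op)
      (l := coindProj X (incl Ψ x b.unop) le_rfl ≫ X.map (homOfLE (trans_pt_le b.unop le_rfl)).op)
      (h := X.map l) ?_)
    refine (congrArg (· ≫ X.map (homOfLE (trans_pt_le c.unop le_rfl)).op)
      (coind_map_proj X ((incl Ψ x).monotone (leOfHom l.unop)) le_rfl)).trans ?_
    exact congrArg (coindProj X (incl Ψ x b.unop) le_rfl ≫ ·) (map_square X _ _ _ _)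

/-- With naturality in `X` (`coindDesc_map`), this half of the adjunction suffices to transport
lifting problems along epimorphisms. -/
theorem coindDesc_lift {F : PSh (Total Ψ)} {X : PSh (Ψ.obj (op x))} (f : fibre F x ⟶ X) :
    coindDesc (coindLift f) = f := by
  ext b : 2
  refine addCommGrp_hom_ext fun a => ?_
  refine (congrArg (fun j => j.hom ((F.map (homOfLE (incl_trans_le (Ψ := Ψ) le_rfl b.unop)).op).hom a))
    (f.naturality (homOfLE (trans_pt_le b.unop le_rfl)).op)).symm.trans ?_
  refine congrArg (f.app b).hom ?_
  refine (congrArg (fun j => j.hom a) (F.map_comp (homOfLE (incl_trans_le le_rfl b.unop)).op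
    (homOfLE ((incl Ψ x).monotone (trans_pt_le b.unop le_rfl))).op).symm).trans ?_
  exact congrArg (fun j => j.hom a) (F.map_id (op (incl Ψ x b.unop)))

theorem coindDesc_map {F : PSh (Total Ψ)} {X X' : PSh (Ψ.obj (op x))} (g : F ⟶ (coind x).obj X)
    (k : X ⟶ X') : coindDesc (g ≫ (coind x).map k) = coindDesc g ≫ k := by
  ext b : 2
  refine addCommGrp_hom_ext fun a => ?_
  exact congrArg (fun j => j.hom (((g.app (op (incl Ψ x b.unop))).hom a :
    ∀ h : PLift (x ≤ x), X.obj (op (trans Ψ h.1 b.unop))) ⟨le_rfl⟩))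
      (k.naturality (homOfLE (trans_pt_le b.unop le_rfl)).op).symm

/-- The value of `coind` at a point is a product, over proofs of `x ≤ π(s)`, of values of the
presheaf, and a product of surjections is surjective. -/
theorem epi_coind_map {X X' : PSh (Ψ.obj (op x))} (k : X ⟶ X') [Epi k] :
    Epi ((coind x).map k) := by
  refine (NatTrans.epi_iff_epi_app _).2 fun s => (AddCommGrpCat.epi_iff_surjective _).2 ?_
  intro m
  have hk (h : PLift (x ≤ s.unop.base)) : Function.Surjective (k.app (op (trans Ψ h.1 s.unop.pt))).hom :=
    (AddCommGrpCat.epi_iff_surjective _).1 ((NatTrans.epi_iff_epi_app k).1 inferInstance _)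
  exact ⟨fun h => (hk h (m h)).choose, funext fun h => (hk h (m h)).choose_spec⟩

/-- A lifting problem for the restriction of `F` against `e` is transposed to one for `F` against
`coind e`, which is still an epimorphism. -/
instance : (pull (incl Ψ x)).PreservesProjectiveObjects where
  projective_obj {F} hF :=
    { factors := fun {X X'} f e he => by
        have := epi_coind_map e
        refine ⟨coindDesc (Projective.factorThru (coindLift f) ((coind x).map e)), ?_⟩
        rw [← coindDesc_map, Projective.factorThru_comp, coindDesc_lift] }

end Restriction

/-! ### Fibre homology as the homology of the pushed-forward resolution -/

section FibreHomology

variable {B : Type u} [PartialOrder B] {Ψ : Bᵒᵖ ⥤ PartOrd.{u}}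

/-- The complex of presheaves `π_! P`, for a projective resolution `P`. -/
noncomputable abbrev pushCx {F : PSh (Total Ψ)} (P : ProjectiveResolution F) :
    ChainComplex (PSh B) ℕ :=
  ((push Ψ).mapHomologicalComplex _).obj P.complex

/-- The restriction of a projective resolution to a fibre. -/
noncomputable abbrev fibreRes {F : PSh (Total Ψ)} (P : ProjectiveResolution F) (x : B) :
    ProjectiveResolution (fibre F x) :=
  (pull (incl Ψ x)).mapProjectiveResolution P

/-- The restriction maps of a resolution, as a chain map. -/
noncomputable def fibreResMap {F : PSh (Total Ψ)} (P : ProjectiveResolution F) {x y : B}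
    (h : x ≤ y) : RelHom (pull (trans Ψ h)) (fibreRes P y).complex (fibreRes P x).complex where
  f i := (fibreHom (P.complex.X i) (trans Ψ h) (incl_trans_le h)).toPull
  comm i j := by
    ext b : 2
    exact ((P.complex.d i j).naturality (homOfLE (incl_trans_le h b.unop)).op)

theorem fibreResMap_aug {F : PSh (Total Ψ)} (P : ProjectiveResolution F) {x y : B}
    (h : x ≤ y) : (fibreResMap P h).f 0 ≫ (pull (trans Ψ h)).map (aug (fibreRes P x)) =
      aug (fibreRes P y) ≫ (fibreHom F (trans Ψ h) (incl_trans_le h)).toPull := by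
  rw [aug_mapProjectiveResolution, aug_mapProjectiveResolution]
  ext b : 2
  exact (aug P).naturality (homOfLE (incl_trans_le h b.unop)).op

/-- This identifies the chain map inducing the restriction maps of `H_n(Ψ; F)` with the restriction
maps of the complex `π_! P`. -/
theorem chainComp_fibreResMap_f {F : PSh (Total Ψ)} (P : ProjectiveResolution F) {x y : B}
    (h : x ≤ y) (i : ℕ) :
    (chainComp (tensorComparison (constZHom (trans Ψ h))) (fibreResMap P h)).f i =
      pushMap (P.complex.X i) h :=
  tensorHom_map _ _ _ _ fun _ => Category.comp_id _

/-- The value of the homology of `π_! P` at `x`. -/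
noncomputable def fibreHomologyIsoApp {F : PSh (Total Ψ)} (P : ProjectiveResolution F) (n : ℕ)
    (x : Bᵒᵖ) : (fibreHomology n F).obj x ≅ ((pushCx P).homology n).obj x :=
  -- The complex `P|_{Ψ(x)} ⊗ ℤ` is by construction the value of `π_! P` at `x`, and evaluation at
  -- `x` commutes with homology.
  (fibreRes P x.unop).isoLeftDerivedObj (tensorWith (constZ _)) n ≪≫
    ((pushCx P).sc n).mapHomologyIso ((evaluation _ _).obj x)

/-- The presheaf `H_n(Ψ; F)` is the homology of `π_! P`, where `P` is a projective resolution
of `F`. -/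
noncomputable def fibreHomologyIso {F : PSh (Total Ψ)} (P : ProjectiveResolution F) (n : ℕ) :
    fibreHomology n F ≅ (pushCx P).homology n :=
  NatIso.ofComponents (fibreHomologyIsoApp P n) fun {x y} h => by
    -- The restriction map of `H_n(Ψ; F)` can be computed with the restrictions of `P` to the two
    -- fibres instead of the resolutions chosen in its definition.
    have e1 := derivedMap_comp_isoLeftDerivedObj
      (tensorComparison (constZHom (trans Ψ (leOfHom h.unop)))) _ n (fibreRes P x.unop)
      (fibreRes P y.unop) (fibreResMap P (leOfHom h.unop)) (fibreResMap_aug P (leOfHom h.unop))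
    -- Evaluation of presheaves is natural in the point, so its comparison with homology respects
    -- restriction maps.
    have e2 := ((Iso.eq_inv_comp _).1 (NatTrans.app_homology
      ((evaluation Bᵒᵖ AddCommGrpCat.{u}).map h) ((pushCx P).sc n))).symm
    have e3 : HomologicalComplex.homologyMap
        (chainComp (tensorComparison (constZHom (trans Ψ (leOfHom h.unop))))
          (fibreResMap P (leOfHom h.unop))) n = ShortComplex.homologyMap
          (((pushCx P).sc n).mapNatTrans ((evaluation _ _).map h)) := by
      have e4 : (HomologicalComplex.shortComplexFunctor AddCommGrpCat.{u} (ComplexShape.down ℕ)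
          n).map (chainComp (tensorComparison (constZHom (trans Ψ (leOfHom h.unop))))
            (fibreResMap P (leOfHom h.unop))) =
              ((pushCx P).sc n).mapNatTrans ((evaluation _ _).map h) := by
        refine ShortComplex.Hom.ext ?_ ?_ ?_ <;> exact chainComp_fibreResMap_f P _ _
      exact congrArg (fun k => ShortComplex.homologyMap k) e4
    exact comm_paste e1 ((congrArg (· ≫ _) e3).trans e2)

/-- The complex `π_! P ⊗ G` computes `Tor(F, π^* G)`. -/
noncomputable def torPullIso {F : PSh (Total Ψ)} (P : ProjectiveResolution F) (G : CoPSh B) (n : ℕ) :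
    Tor n F ((copull (proj Ψ)).obj G) ≅
      (((tensorWith G).mapHomologicalComplex _).obj (pushCx P)).homology n :=
  P.isoLeftDerivedObj (tensorWith ((copull (proj Ψ)).obj G)) n ≪≫
    (HomologicalComplex.homologyFunctor _ _ n).mapIso
      ((NatIso.mapHomologicalComplex (projectionFormula Ψ G) _).app P.complex)

end FibreHomology

end PosetTor

theorem mainTheorem5 {B : Type u} [PartialOrder B] (Ψ : Bᵒᵖ ⥤ PartOrd.{u})
    (F : PosetTor.PSh (PosetTor.Total Ψ)) (G : PosetTor.CoPSh B) :
    ∃ E : PosetTor.SpecSeq.{u},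
      (∀ p q : ℕ, Nonempty
        ((E.page 2 le_rfl).X (p, q) ≅ PosetTor.Tor q (PosetTor.fibreHomology p F) G)) ∧
      PosetTor.Converges E
        (fun n => PosetTor.Tor n F ((PosetTor.copull (PosetTor.proj Ψ)).obj G)) := by
  let P := projectiveResolution F
  have (p : ℕ) : Projective ((PosetTor.pushCx P).X p) :=
    have := P.projective p
    PosetTor.projective_push (P.complex.X p)
  -- `π_! P` consists of projectives and `π_! P ⊗ G` computes the abutment, so the hyper-`Tor`
  -- spectral sequence applies; its second page involves the homology of `π_! P`, that is, the fibre
  -- homology.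
  obtain ⟨E, hE, hconv⟩ := PosetTor.exists_hyperTor_specSeq (PosetTor.pushCx P) G _
    (PosetTor.torPullIso P G)
  exact ⟨E, fun p q => (hE p q).map fun e =>
    e ≪≫ ((PosetTor.tensorWith G).leftDerived q).mapIso (PosetTor.fibreHomologyIso P p).symm, hconv⟩
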